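/- \textbf{Conventions.} A plane graph is a graph with a fixed planar embedding and a designated external face, whose boundary is the contour; nodes and edges on the contour are external, the others are internal. A plane triangulation is a simple connected plane graph with $n\ge 3$ nodes all of whose faces, including the external one, are triangles. Let $T$ be a rooted spanning tree of a plane graph $G$ whose root lies on the contour. Two nodes are unrelated if neither is an ancestor of the other in $T$. Let $v_1,\dots,v_n$ be the counterclockwise preordering of $T$: the preordering in which the children of a node are visited in counterclockwise order, starting after the edge to its parent, or, at the root $v_1$, after the corner of the external face. $T$ is an \emph{orderly spanning tree} of $G$ if $v_1$ is on the contour and, for each $i$, the neighbors of $v_i$ in $G$ form the following four (possibly empty) blocks in counterclockwise order around $v_i$: $B_1(v_i)$, the parent of $v_i$ in $T$; $B_2(v_i)$, the neighbors $v_j$ with $j<i$ unrelated to $v_i$; $B_3(v_i)$, the children of $v_i$ in $T$; $B_4(v_i)$, the neighbors $v_j$ with $j>i$ unrelated to $v_i$. A triple $(T_1,T_2,T_n)$ of rooted trees in $G$ is a \emph{realizer} of the plane triangulation $G$ if (a) the edge sets of $T_1,T_2,T_n$ partition the set of internal edges of $G$, and the three roots are distinct external nodes; and (b) every internal node $v$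 has a parent in each of the three trees, and the neighbors of $v$ form six blocks $U_1,D_n,U_2,D_1,U_n,D_2$ in counterclockwise order around $v$, where $U_j$ consists of the parent and $D_j$ of the children of $v$ in $T_j$. \textbf{Statement.} There are a random access machine program and a constant $C$ such that the following holds for every $n$-node plane triangulation $G$ and every orderly spanning tree $T$ of $G$, with counterclockwise preordering $v_1,\dots,v_n$. Given $G$, as the doubly linked circular lists of the neighbors of each node in counterclockwise order, with the two copies of each edge cross-linked and with a pointer to the external face, and $T$, by its root and the parent of each node, the program halts after at most $Cn$ steps and outputs, by their roots and the parents of their nodes, three rooted trees $T_1,T_2,T_n$ such that 1. $(T_1,T_2,T_n)$ is a realizer of $G$, with roots $v_1,v_2,v_n$ respectively; 2. $(v_1,v_2)$ and $(v_1,v_n)$ are edges of $T$, and the edges of $T_1$ are those of $T$ other than these two; 3. the edges of $T_2$ are the pairs $(v,w)$, where $v$ is an internal node of $G$ and $w$ is the last node of $B_2(v)$ in counterclockwise order around $v$; 4. the edges of $T_n$ are the pairs $(v,w)$, where $v$ is an internal node of $G$ and $w$ is the first node of $B_4(v)$ in counterclockwise order around $v$. -/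

import Mathlib

/-! ## Plane graphs, given by the counterclockwise order of the edges around each node -/

/-- A simple graph with a rotation system.  A dart `d` is an edge directed from `d.fst` to `d.snd`;
`next d` is the dart that follows `d` in counterclockwise order around the node `d.fst`. -/
structure RotationSystem (V : Type*) where
  graph : SimpleGraph V
  next : Equiv.Perm graph.Dart
  next_fst : ∀ d, (next d).fst = d.fst
  next_sameCycle : ∀ d e : graph.Dart, d.fst = e.fst → next.SameCycle d e

namespace RotationSystem

variable {V : Type*} (R : RotationSystem V)

/-- The boundary walk of the face on the left of a dart: after `u → v` it uses the dart that
immediately precedes `v → u` in counterclockwise order around `v`. -/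
def facePerm : Equiv.Perm R.graph.Dart :=
  R.next⁻¹ * Function.Involutive.toPerm _ (SimpleGraph.Dart.symm_involutive (G := R.graph))

/-- The faces are the orbits of `facePerm`. -/
def Face : Type _ := Quotient (Equiv.Perm.SameCycle.setoid R.facePerm)

/-- The face on the left of the dart `d`. Equivalently, the face in the corner at `d.fst` between
`d` and `next d`. -/
def face (d : R.graph.Dart) : R.Face := Quotient.mk _ d

end RotationSystem

/-- A connected plane graph (with at least one edge): the rotation system of a connected graph that
satisfies Euler's formula, i.e. that has genus 0, and one of its faces as the external face. -/
structure PlaneGraph (V : Type*) extends RotationSystem V where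
  connected : graph.Connected
  euler : Nat.card V + Nat.card toRotationSystem.Face = graph.edgeSet.ncard + 2
  outer : toRotationSystem.Face

/-- A rooted tree that is a subgraph of `G`. -/
structure RootedSubtree {V : Type*} (G : SimpleGraph V) where
  tree : G.Subgraph
  root : V
  root_mem : root ∈ tree.verts
  isTree : tree.coe.IsTree

namespace RootedSubtree

variable {V : Type*} {G : SimpleGraph V} (T : RootedSubtree G)

/-- The number of edges of `T` between the root and `v`. -/
noncomputable def depth (v : V) : ℕ := T.tree.spanningCoe.dist T.root v

/-- `u` is the parent of `v` in `T`. -/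
def IsParent (u v : V) : Prop := T.tree.Adj u v ∧ T.depth v = T.depth u + 1

/-- `u` is an ancestor of `v` in `T`, possibly `v` itself. -/
def IsAncestor (u v : V) : Prop := Relation.ReflTransGen T.IsParent u v

/-- Neither of `u`, `v` is an ancestor of the other (in particular `u ≠ v`). -/
def Unrelated (u v : V) : Prop := ¬ T.IsAncestor u v ∧ ¬ T.IsAncestor v u

end RootedSubtree

namespace PlaneGraph

variable {V : Type*} (M : PlaneGraph V)

/-- A plane triangulation: at least three nodes, and every face (the external one included) is a
triangle.  The graph is simple, so a face whose boundary walk closes up after three steps has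
exactly three distinct nodes. -/
def IsTriangulation : Prop :=
  3 ≤ Nat.card V ∧ ∀ d, M.facePerm (M.facePerm (M.facePerm d)) = d

/-- `v` lies on the contour. -/
def IsExternalNode (v : V) : Prop := ∃ d : M.graph.Dart, M.face d = M.outer ∧ d.fst = v

/-- `v` does not lie on the contour. -/
def IsInternalNode (v : V) : Prop := ¬ M.IsExternalNode v

/-- The edges of the contour. -/
def externalEdges : Set (Sym2 V) := {e | ∃ d : M.graph.Dart, M.face d = M.outer ∧ d.edge = e}

/-- The edges that are not on the contour. -/
def internalEdges : Set (Sym2 V) := M.graph.edgeSet \ M.externalEdges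

/-- The neighbors of `v` form the blocks `B 0, B 1, …, B (m - 1)` in counterclockwise order around
`v`: if the neighbors are listed in counterclockwise order from a suitable one, each of them belongs
to exactly one block, and the indices of the blocks do not decrease.  Blocks may be empty. -/
def NeighborsFormBlocks (v : V) {m : ℕ} (B : Fin m → Set V) : Prop :=
  ∃ (d : M.graph.Dart) (label : ℕ → Fin m), d.fst = v ∧ Monotone label ∧
    ∀ k < (M.graph.neighborSet v).ncard, ∀ a, ((M.next ^ k) d).snd ∈ B a ↔ label k = a

/-- `w` is the last node of the block `S` of neighbors of `v` in counterclockwise order. -/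
def IsLastInBlock (v : V) (S : Set V) (w : V) : Prop :=
  ∃ d : M.graph.Dart, d.fst = v ∧ d.snd = w ∧ w ∈ S ∧ (M.next d).snd ∉ S

/-- `w` is the first node of the block `S` of neighbors of `v` in counterclockwise order. -/
def IsFirstInBlock (v : V) (S : Set V) (w : V) : Prop :=
  ∃ d : M.graph.Dart, d.fst = v ∧ d.snd = w ∧ w ∈ S ∧ (M.next⁻¹ d).snd ∉ S

variable (T : RootedSubtree M.graph)

/-- The dart from which the children of the node `d.fst` are listed in counterclockwise order: the
dart to the parent, and at the root the first dart after the corner of the external face. -/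
def IsBaseDart (d : M.graph.Dart) : Prop :=
  T.IsParent d.snd d.fst ∨ (d.fst = T.root ∧ M.face (M.next⁻¹ d) = M.outer)

/-- `a` and `b` are distinct children of `p`, and `a` comes before `b` in the counterclockwise
order of the children of `p`. -/
def ChildBefore (p a b : V) : Prop :=
  T.IsParent p a ∧ T.IsParent p b ∧
    ∃ (d : M.graph.Dart) (i j : ℕ), d.fst = p ∧ M.IsBaseDart T d ∧
      i < j ∧ j < (M.graph.neighborSet p).ncard ∧
      ((M.next ^ i) d).snd = a ∧ ((M.next ^ j) d).snd = b

/-- `x` strictly precedes `y` in the counterclockwise preordering of `T`. -/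
def Precedes (x y : V) : Prop :=
  (x ≠ y ∧ T.IsAncestor x y) ∨
    ∃ p a b, M.ChildBefore T p a b ∧ T.IsAncestor a x ∧ T.IsAncestor b y

/-- The parent of `v`. -/
def B₁ (v : V) : Set V := {u | T.IsParent u v}

/-- The neighbors of `v` that are unrelated to `v` and precede `v`. -/
def B₂ (v : V) : Set V := {u | M.graph.Adj v u ∧ T.Unrelated u v ∧ M.Precedes T u v}

/-- The children of `v`. -/
def B₃ (v : V) : Set V := {u | T.IsParent v u}

/-- The neighbors of `v` that are unrelated to `v` and succeed `v`. -/
def B₄ (v : V) : Set V := {u | M.graph.Adj v u ∧ T.Unrelated u v ∧ M.Precedes T v u}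

def IsOrderlyNode (v : V) : Prop :=
  M.NeighborsFormBlocks v ![M.B₁ T v, M.B₂ T v, M.B₃ T v, M.B₄ T v]

/-- `T` is an orderly spanning tree of the plane graph. -/
def IsOrderlySpanningTree : Prop :=
  T.tree.IsSpanning ∧ M.IsExternalNode T.root ∧ ∀ v, M.IsOrderlyNode T v

/-- `v` is the second node in the counterclockwise preordering of the spanning tree `T`. -/
def IsSecondNode (v : V) : Prop :=
  v ≠ T.root ∧ ∀ u, u ≠ T.root → u ≠ v → M.Precedes T v u

/-- `v` is the last node in the counterclockwise preordering of the spanning tree `T`. -/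
def IsLastNode (v : V) : Prop := ∀ u, u ≠ v → M.Precedes T u v

/-- Schnyder's realizers: the internal edges are partitioned into three trees rooted at distinct
external nodes; each internal node has a parent in each tree, and its neighbors form the blocks
`U₁, Dₙ, U₂, D₁, Uₙ, D₂` in counterclockwise order, where `U` stands for the parent and `D` for the
children in the respective tree. -/
structure IsRealizer (T₁ T₂ Tₙ : RootedSubtree M.graph) : Prop where
  external₁ : M.IsExternalNode T₁.root
  external₂ : M.IsExternalNode T₂.root
  externalₙ : M.IsExternalNode Tₙ.root
  root_ne₁₂ : T₁.root ≠ T₂.root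
  root_ne₁ₙ : T₁.root ≠ Tₙ.root
  root_ne₂ₙ : T₂.root ≠ Tₙ.root
  disjoint₁₂ : Disjoint T₁.tree.edgeSet T₂.tree.edgeSet
  disjoint₁ₙ : Disjoint T₁.tree.edgeSet Tₙ.tree.edgeSet
  disjoint₂ₙ : Disjoint T₂.tree.edgeSet Tₙ.tree.edgeSet
  union : T₁.tree.edgeSet ∪ T₂.tree.edgeSet ∪ Tₙ.tree.edgeSet = M.internalEdges
  parent : ∀ v, M.IsInternalNode v →
    (∃ u, T₁.IsParent u v) ∧ (∃ u, T₂.IsParent u v) ∧ (∃ u, Tₙ.IsParent u v)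
  blocks : ∀ v, M.IsInternalNode v → M.NeighborsFormBlocks v
    ![{u | T₁.IsParent u v}, {u | Tₙ.IsParent v u}, {u | T₂.IsParent u v},
      {u | T₁.IsParent v u}, {u | Tₙ.IsParent u v}, {u | T₂.IsParent v u}]

end PlaneGraph

/-! ## Random access machines

A program uses a fixed finite number of registers and of arrays of natural numbers.  Its only
arithmetic operations are "add one" and "subtract one", so that the numbers that occur exceed those
of the input and of the program text by at most the number of steps; hence unit cost is adequate. -/

namespace RAM

/-- The contents of the registers and of the arrays. -/
structure State where
  reg : ℕ → ℕ
  mem : ℕ → ℕ → ℕ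

namespace State

def setReg (s : State) (x k : ℕ) : State := { s with reg := Function.update s.reg x k }

def setMem (s : State) (a i k : ℕ) : State :=
  { s with mem := Function.update s.mem a (Function.update (s.mem a) i k) }

end State

/-- Comparisons of two registers. -/
inductive Test where
  | eq (x y : ℕ)
  | ne (x y : ℕ)
  | lt (x y : ℕ)

def Test.Holds (s : State) : Test → Prop
  | .eq x y => s.reg x = s.reg y
  | .ne x y => s.reg x ≠ s.reg y
  | .lt x y => s.reg x < s.reg y

/-- Programs. The letters `x, y` stand for registers, `a` for an array, `k` for a literal. -/
inductive Program where
  | skip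
  | const (x k : ℕ)
  | copy (x y : ℕ)
  | inc (x : ℕ)
  | dec (x : ℕ)
  | load (x a y : ℕ)
  | store (a y x : ℕ)
  | seq (p q : Program)
  | ite (b : Test) (p q : Program)
  | loop (b : Test) (p : Program)

/-- `Exec p s t s'`: started in the state `s`, the program `p` halts after exactly `t` steps in the
state `s'`.  Every elementary instruction and every evaluation of a test is one step. -/
inductive Exec : Program → State → ℕ → State → Prop where
  | skip (s : State) : Exec .skip s 1 s
  | const (s : State) (x k : ℕ) : Exec (.const x k) s 1 (s.setReg x k)
  | copy (s : State) (x y : ℕ) : Exec (.copy x y) s 1 (s.setReg x (s.reg y))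
  | inc (s : State) (x : ℕ) : Exec (.inc x) s 1 (s.setReg x (s.reg x + 1))
  | dec (s : State) (x : ℕ) : Exec (.dec x) s 1 (s.setReg x (s.reg x - 1))
  | load (s : State) (x a y : ℕ) : Exec (.load x a y) s 1 (s.setReg x (s.mem a (s.reg y)))
  | store (s : State) (a y x : ℕ) : Exec (.store a y x) s 1 (s.setMem a (s.reg y) (s.reg x))
  | seq {p q : Program} {s s' s'' : State} {t t' : ℕ} :
      Exec p s t s' → Exec q s' t' s'' → Exec (.seq p q) s (t + t') s''
  | ite_true {b : Test} {p q : Program} {s s' : State} {t : ℕ} :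
      b.Holds s → Exec p s t s' → Exec (.ite b p q) s (t + 1) s'
  | ite_false {b : Test} {p q : Program} {s s' : State} {t : ℕ} :
      ¬ b.Holds s → Exec q s t s' → Exec (.ite b p q) s (t + 1) s'
  | loop_false {b : Test} {p : Program} {s : State} :
      ¬ b.Holds s → Exec (.loop b p) s 1 s
  | loop_true {b : Test} {p : Program} {s s' s'' : State} {t t' : ℕ} :
      b.Holds s → Exec p s t s' → Exec (.loop b p) s' t' s'' →
      Exec (.loop b p) s (t + t' + 1) s''

end RAM

/-! ## Representation of the input and of the output

The nodes of the graph are the numbers `0, …, n - 1`, in no particular order. -/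

/-- A rooted tree is represented by its root and an array that stores the parent of each node; the
value `n` marks the nodes without a parent. -/
structure RepresentsTree {n : ℕ} {G : SimpleGraph (Fin n)} (T : RootedSubtree G)
    (root : ℕ) (parent : ℕ → ℕ) : Prop where
  root_eq : root = T.root
  parent_eq : ∀ u v : Fin n, T.IsParent u v → parent v = u
  parent_none : ∀ v : Fin n, (¬ ∃ u, T.IsParent u v) → parent v = n

/-- The state `s` holds the plane graph `M` and the rooted tree `T`.  The darts carry distinct
numbers (in no particular order), and form for each node a doubly linked circular list in
counterclockwise order; the two darts of an edge are linked to each other.  Nothing is assumed on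
the remaining contents of the memory. -/
structure RepresentsInput {n D : ℕ} (M : PlaneGraph (Fin n)) (T : RootedSubtree M.graph)
    (num : M.graph.Dart ≃ Fin D) (s : RAM.State) : Prop where
  size : s.reg 0 = n
  outer : ∃ d, M.face d = M.outer ∧ s.reg 1 = num d
  first : ∀ v : Fin n, ∃ d : M.graph.Dart, d.fst = v ∧ s.mem 0 v = num d
  neighbor : ∀ d, s.mem 1 (num d) = d.snd
  next : ∀ d, s.mem 2 (num d) = num (M.next d)
  prev : ∀ d, s.mem 3 (num d) = num (M.next⁻¹ d)
  twin : ∀ d, s.mem 4 (num d) = num d.symm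
  tree : RepresentsTree T (s.reg 2) (s.mem 5)

/-- The state `s` holds the three rooted trees. -/
structure RepresentsOutput {n : ℕ} {G : SimpleGraph (Fin n)} (T₁ T₂ Tₙ : RootedSubtree G)
    (s : RAM.State) : Prop where
  tree₁ : RepresentsTree T₁ (s.reg 3) (s.mem 6)
  tree₂ : RepresentsTree T₂ (s.reg 4) (s.mem 7)
  treeₙ : RepresentsTree Tₙ (s.reg 5) (s.mem 8)

/-! List the neighbors of each node counterclockwise, beginning after its parent (at the root, after
the external corner), and attach to each node the sequence of positions along its path from the
root, `Tour.key`. Ancestors are prefixes, and the preordering is the lexicographic order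
(`isAncestor_iff_prefix`, `precedes_iff`). Orderliness then says that, at a node other than the
root, the positions run through B₂, B₃, B₄, and the parent has the last position
(`mem_B₂_of_pos_le`, `mem_B₄_of_pos_le`, `pos_parent`). Since faces are triangles, a corner at one
node determines the corners at the other two (`Follows.rotate`); this carries information from node
to node.

The contour consists of the root and its first and last child. The corners beside the parent show
that the neighbor right after the parent of `v` lies in B₂(v) unless `v` is the first child, and the
one right before it lies in B₄(v) unless `v` is the last child. So each internal node has its
prescribed parents in T₂ and Tₙ. The former precedes the node and the latter succeeds it in the
preordering, so both choices of parents are acyclic and give trees.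

T₁ uses edges of T, while T₂ and Tₙ use edges between unrelated nodes, so only T₂ and Tₙ could share
an edge. This is excluded by the third node of the triangle beside such an edge
(`not_isLastInBlock_of_isFirstInBlock`). Each tree has n - 3 edges, and by Euler's formula there are
3n - 9 internal edges, so the disjoint trees exhaust them (`union_edgeSet`). The six blocks of a
realizer then arise by splitting the last node off B₂ and the first node off B₄.

The program walks once around T: it crosses tree edges, skips the other edges, and marks a node when
it first enters it. The corresponding permutation of the darts is a single cycle
(`tourStep_isCycleOn`). At a dart `v → w` that is not in T, the node `w` is marked exactly if it
lies in B₂(v), so the marks of `w` and of one adjacent neighbor, and the test whether the latter is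
a child of `v`, decide whether `w` is the required parent of `v` (`isLastInBlock_iff_reached`,
`isFirstInBlock_iff_reached`). There are at most 6n darts, each treated in constant time. -/

namespace RootedSubtree

/-! ### Rooted subtrees and their parent relation. -/

variable {V : Type*} {G : SimpleGraph V} (T : RootedSubtree G)

/-- Walks that start in the tree stay in it, so passing between `spanningCoe` and `coe` preserves
lengths. This makes the distance lemmas for trees available for `depth`. -/
theorem depth_coe (v : T.tree.verts) :
    T.depth v = T.tree.coe.dist ⟨T.root, T.root_mem⟩ v := by
  have key : ∀ (a b : V) (p : T.tree.spanningCoe.Walk a b) (ha : a ∈ T.tree.verts)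
      (hb : b ∈ T.tree.verts), ∃ q : T.tree.coe.Walk ⟨a, ha⟩ ⟨b, hb⟩, q.length = p.length := by
    intro a b p
    induction p with
    | nil => exact fun ha hb => ⟨.nil, rfl⟩
    | cons h p ih =>
      intro ha hb
      obtain ⟨q, hq⟩ := ih (T.tree.edge_vert (T.tree.adj_symm h)) hb
      exact ⟨.cons (show T.tree.coe.Adj ⟨_, ha⟩ ⟨_, T.tree.edge_vert (T.tree.adj_symm h)⟩ from h) q,
        by simp [hq]⟩
  obtain ⟨q, hq⟩ := T.isTree.connected.exists_walk_length_eq_dist ⟨T.root, T.root_mem⟩ v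
  have hle := SimpleGraph.dist_le (q.map T.tree.coeEmbeddingSpanningCoe.toHom)
  have hreach : T.tree.spanningCoe.Reachable T.root v :=
    ⟨q.map T.tree.coeEmbeddingSpanningCoe.toHom⟩
  obtain ⟨p, hp⟩ := hreach.exists_walk_length_eq_dist
  obtain ⟨q', hq'⟩ := key _ _ p T.root_mem v.2
  have hle' := SimpleGraph.dist_le q'
  rw [SimpleGraph.Walk.length_map] at hle
  have h1 : T.depth v ≤ q.length := hle
  have h2 : T.depth v = p.length := hp.symm
  apply le_antisymm
  · omega
  · rw [h2, ← hq']; exact hle'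

@[simp] theorem depth_root : T.depth T.root = 0 := by simp [depth]

theorem isParent_or_of_adj {u v : V} (h : T.tree.Adj u v) : T.IsParent u v ∨ T.IsParent v u := by
  have hd := T.isTree.dist_eq_dist_add_one_of_adj ⟨T.root, T.root_mem⟩ h.coe
  rw [← T.depth_coe, ← T.depth_coe] at hd
  rcases hd with hd | hd
  · exact .inr ⟨h.symm, hd⟩
  · exact .inl ⟨h, hd⟩

/-- Geodesics from the root through `u` and through `u'` are both paths to `v`; a tree has only one,
and its penultimate node is the parent. -/
theorem IsParent.unique {T : RootedSubtree G} {u u' v : V} (h : T.IsParent u v)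
    (h' : T.IsParent u' v) : u = u' := by
  obtain ⟨h, hd⟩ := h
  obtain ⟨h', hd'⟩ := h'
  have e := T.depth_coe ⟨v, T.tree.edge_vert h.symm⟩
  have eu := T.depth_coe ⟨u, T.tree.edge_vert h⟩
  have eu' := T.depth_coe ⟨u', T.tree.edge_vert h'⟩
  obtain ⟨p, hp⟩ := T.isTree.connected.exists_walk_length_eq_dist
    ⟨T.root, T.root_mem⟩ ⟨u, T.tree.edge_vert h⟩
  obtain ⟨p', hp'⟩ := T.isTree.connected.exists_walk_length_eq_dist
    ⟨T.root, T.root_mem⟩ ⟨u', T.tree.edge_vert h'⟩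
  have q := (p.concat h.coe).isPath_of_length_eq_dist
    (by rw [SimpleGraph.Walk.length_concat, hp, ← e, ← eu]; exact hd.symm)
  have q' := (p'.concat h'.coe).isPath_of_length_eq_dist
    (by rw [SimpleGraph.Walk.length_concat, hp', ← e, ← eu']; exact hd'.symm)
  have := congrArg SimpleGraph.Walk.penultimate (congrArg Subtype.val
    ((T.isTree.isAcyclic.subsingleton_path _ _).elim ⟨_, q⟩ ⟨_, q'⟩))
  simpa using this

theorem exists_isParent {v : V} (hv : v ∈ T.tree.verts) (hne : v ≠ T.root) :
    ∃ u, T.IsParent u v := by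
  obtain ⟨p, hp⟩ := T.isTree.connected.exists_walk_length_eq_dist
    ⟨v, hv⟩ ⟨T.root, T.root_mem⟩
  cases p with
  | nil => exact absurd rfl hne
  | @cons _ w _ h p =>
    refine ⟨w, ?_⟩
    rcases T.isParent_or_of_adj (u := v) (v := w) h with h' | h'
    · have h1 := h'.2
      have h2 := T.depth_coe ⟨v, hv⟩
      have h3 := T.depth_coe w
      have h4 := SimpleGraph.dist_le p
      rw [SimpleGraph.dist_comm] at h4 hp
      rw [SimpleGraph.Walk.length_cons] at hp
      change T.depth v = _ at h2
      omega
    · exact h'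

theorem not_isParent_root (u : V) : ¬ T.IsParent u T.root := fun h => by
  simpa using h.2

theorem mem_edgeSet_iff {u v : V} :
    s(u, v) ∈ T.tree.edgeSet ↔ T.IsParent u v ∨ T.IsParent v u :=
  ⟨T.isParent_or_of_adj, fun h => h.elim And.left fun h => h.1.symm⟩

theorem IsParent.ne {T : RootedSubtree G} {u v : V} (h : T.IsParent u v) : u ≠ v := h.1.ne

theorem IsParent.adj {T : RootedSubtree G} {u v : V} (h : T.IsParent u v) : G.Adj u v := h.1.adj_sub

theorem IsParent.asymm {T : RootedSubtree G} {u v : V} (h : T.IsParent u v) :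
    ¬ T.IsParent v u := fun h' => by
  have := h.2
  have := h'.2
  omega

/-- A rooted tree that is given by the parents of its nodes: `S` is the set of the nodes other than
the root, and `rank` decreases from each of them to its parent. -/
theorem exists_of_parent [Finite V] (G : SimpleGraph V) (r : V) (S : Set V) (par : V → V)
    (rank : V → ℕ) (hr : r ∉ S) (hadj : ∀ v ∈ S, G.Adj v (par v))
    (hmem : ∀ v ∈ S, par v ∈ S ∨ par v = r) (hrank : ∀ v ∈ S, rank (par v) < rank v) :
    ∃ T : RootedSubtree G, T.root = r ∧ (∀ u v, T.IsParent u v ↔ v ∈ S ∧ u = par v) ∧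
      T.tree.edgeSet = (fun v => s(v, par v)) '' S ∧ T.tree.edgeSet.ncard = S.ncard := by
  let H : G.Subgraph :=
    { verts := insert r S
      Adj := fun u v => (u ∈ S ∧ v = par u) ∨ (v ∈ S ∧ u = par v)
      adj_sub := by
        rintro u v (⟨h, rfl⟩ | ⟨h, rfl⟩)
        · exact hadj u h
        · exact (hadj v h).symm
      edge_vert := by
        rintro u v (⟨h, rfl⟩ | ⟨h, rfl⟩)
        · exact .inr h
        · exact (hmem v h).symm
      symm := ⟨fun u v h => h.symm⟩ }
  have hedge : H.edgeSet = (fun v => s(v, par v)) '' S := by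
    ext e
    induction e using Sym2.ind with
    | _ u v =>
      rw [SimpleGraph.Subgraph.mem_edgeSet]
      constructor
      · rintro (⟨h, rfl⟩ | ⟨h, rfl⟩)
        · exact ⟨u, h, rfl⟩
        · exact ⟨v, h, Sym2.eq_swap⟩
      · rintro ⟨w, hw, h⟩
        rcases Sym2.eq_iff.mp h with ⟨rfl, rfl⟩ | ⟨rfl, rfl⟩
        · exact .inl ⟨hw, rfl⟩
        · exact .inr ⟨hw, rfl⟩
  -- Two nodes with the same edge would be parents of each other, against the decrease of `rank`.
  -- Hence there are exactly as many edges as nodes other than `r`, and connectedness suffices for a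
  -- tree.
  have hinj : Set.InjOn (fun v => s(v, par v)) S := by
    intro v hv w hw h
    rcases Sym2.eq_iff.mp h with ⟨h, -⟩ | ⟨h1, h2⟩
    · exact h
    · have := hrank v hv
      have := hrank w hw
      rw [h2] at *
      rw [← h1] at *
      omega
  have hcard : H.edgeSet.ncard = S.ncard := by rw [hedge, hinj.ncard_image]
  have hrv : r ∈ H.verts := Set.mem_insert _ _
  have hreach : ∀ k, ∀ v, ∀ hv : v ∈ H.verts, rank v = k →
      H.coe.Reachable ⟨r, hrv⟩ ⟨v, hv⟩ := by
    intro k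
    induction k using Nat.strong_induction_on with
    | _ k ih =>
      rintro v (rfl | hv) hk
      · rfl
      · have hp : par v ∈ H.verts := (hmem v hv).symm
        refine (ih _ (hk ▸ hrank v hv) (par v) hp rfl).trans ?_
        exact SimpleGraph.Adj.reachable (.inr ⟨hv, rfl⟩)
  have htree : H.coe.IsTree := by
    have : Finite H.verts := Subtype.finite
    rw [SimpleGraph.isTree_iff_connected_and_card]
    constructor
    · have : Nonempty H.verts := ⟨⟨r, hrv⟩⟩
      exact ⟨fun u v => (hreach _ u u.2 rfl).symm.trans (hreach _ v v.2 rfl)⟩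
    · have h1 : Nat.card H.coe.edgeSet = H.edgeSet.ncard := by
        rw [← H.image_coe_edgeSet_coe,
          Set.ncard_image_of_injective _ (Sym2.map.injective Subtype.val_injective)]
        rfl
      have h2 : Nat.card H.verts = S.ncard + 1 := by
        rw [← Set.ncard_insert_of_notMem hr (Set.toFinite S)]
        rfl
      rw [h1, hcard, h2]
  let T : RootedSubtree G := ⟨H, r, hrv, htree⟩
  -- The edge to `par v` could be oriented the other way only if `v` were the parent of `par v`. By
  -- induction on the rank, `v` would then be `par (par v)`, of smaller rank, or else the root `r`
  -- would have a parent.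
  have hpar : ∀ k, ∀ v ∈ S, rank v = k → T.IsParent (par v) v := by
    intro k
    induction k using Nat.strong_induction_on with
    | _ k ih =>
      intro v hv hk
      have hA : T.tree.Adj (par v) v := .inr ⟨hv, rfl⟩
      rcases T.isParent_or_of_adj hA with h | h
      · exact h
      · rcases hmem v hv with hp | hp
        · have := ih _ (hk ▸ hrank v hv) (par v) hp rfl
          have h1 := hrank v hv
          have h2 := hrank _ hp
          rw [this.unique h] at h2
          omega
        · rw [hp] at h
          exact absurd h (T.not_isParent_root v)
  refine ⟨T, rfl, fun u v => ⟨fun h => ?_, fun h => h.2 ▸ hpar _ v h.1 rfl⟩, hedge, hcard⟩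
  rcases h.1 with ⟨hu, rfl⟩ | hv
  · exact absurd (hpar _ u hu rfl) h.asymm
  · exact hv

end RootedSubtree

/-! ### Lexicographic order on sequences of positions. -/

namespace List

theorem append_lt_append_left_iff {q a b : List ℕ} : q ++ a < q ++ b ↔ a < b := by
  induction q with
  | nil => simp
  | cons x q ih => simp [ih]

theorem lt_iff_exists_prefix {l m : List ℕ} :
    l < m ↔ (l <+: m ∧ l ≠ m) ∨
      ∃ q i j r s, l = q ++ i :: r ∧ m = q ++ j :: s ∧ i < j := by
  constructor
  · induction l generalizing m with
    | nil =>
      intro h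
      exact .inl ⟨nil_prefix, fun e => by simp [← e] at h⟩
    | cons a l ih =>
      cases m with
      | nil => intro h; simp at h
      | cons b m =>
        intro h
        rw [cons_lt_cons_iff] at h
        rcases h with h | ⟨rfl, h⟩
        · exact .inr ⟨[], a, b, l, m, rfl, rfl, h⟩
        · rcases ih h with ⟨h1, h2⟩ | ⟨q, i, j, r, s, rfl, rfl, hij⟩
          · exact .inl ⟨(prefix_cons_inj a).mpr h1, by simpa using h2⟩
          · exact .inr ⟨a :: q, i, j, r, s, rfl, rfl, hij⟩
  · rintro (⟨h1, h2⟩ | ⟨q, i, j, r, s, rfl, rfl, hij⟩)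
    · obtain ⟨r, rfl⟩ := h1
      cases r with
      | nil => simp at h2
      | cons x r => simpa using (append_lt_append_left_iff (q := l) (a := [])).mpr (nil_lt_cons x r)
    · exact append_left_lt (cons_lt_cons_iff.mpr (.inl hij))

theorem append_lt_append_of_not_prefix {a b : List ℕ} (h : a < b) (hp : ¬ a <+: b)
    (c d : List ℕ) : a ++ c < b ++ d := by
  rcases lt_iff_exists_prefix.mp h with h | ⟨q, i, j, r, s, rfl, rfl, hij⟩
  · exact absurd h.1 hp
  · exact lt_iff_exists_prefix.mpr
      (.inr ⟨q, i, j, r ++ c, s ++ d, by simp, by simp, hij⟩)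

/-- What a traversal uncovers when it advances by one position at the node with key `q`: the subtree
hanging at position `i`, and nothing else. -/
theorem lt_concat_succ_iff {l q : List ℕ} {i : ℕ} :
    l < q ++ [i + 1] ↔ l < q ++ [i] ∨ (q ++ [i]) <+: l := by
  constructor
  · intro h
    by_contra! hc
    obtain ⟨h1, h2⟩ := hc
    have hlt : q ++ [i] < l := lt_of_le_of_ne h1 fun e => h2 (e ▸ prefix_rfl)
    rcases lt_iff_exists_prefix.mp hlt with h' | ⟨p, a, b, r, s, e, rfl, hab⟩
    · exact h2 h'.1
    · rcases eq_nil_or_concat' r with rfl | ⟨r, x, rfl⟩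
      · obtain ⟨rfl, e⟩ := append_inj' e (by simp)
        obtain rfl : i = a := by simpa using e
        rw [append_lt_append_left_iff, cons_lt_cons_iff] at h
        rcases h with h | ⟨-, h⟩
        · omega
        · simp at h
      · obtain ⟨rfl, -⟩ : q = p ++ a :: r ∧ [i] = [x] := append_inj' (by simpa using e) (by simp)
        refine absurd h (not_lt_of_ge (le_of_lt ?_))
        exact lt_iff_exists_prefix.mpr (.inr ⟨p, a, b, r ++ [i + 1], s, by simp, rfl, hab⟩)
  · rintro (h | ⟨r, rfl⟩)
    · exact h.trans (append_left_lt (by simp [cons_lt_cons_iff]))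
    · rw [append_assoc, append_lt_append_left_iff]
      simp [cons_lt_cons_iff]

theorem lt_concat_zero_iff {l q : List ℕ} : l < q ++ [0] ↔ l ≤ q := by
  constructor
  · intro h
    by_contra! hc
    rcases lt_iff_exists_prefix.mp hc with ⟨⟨r, rfl⟩, h'⟩ | ⟨p, a, b, r, s, rfl, rfl, hab⟩
    · rw [append_lt_append_left_iff] at h
      cases r with
      | nil => simp at h'
      | cons x r => simp [cons_lt_cons_iff] at h
    · refine absurd h (not_lt_of_ge (le_of_lt ?_))
      exact lt_iff_exists_prefix.mpr (.inr ⟨p, a, b, r ++ [0], s, by simp, rfl, hab⟩)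
  · intro h
    exact h.trans_lt (lt_iff_exists_prefix.mpr (.inl ⟨prefix_append _ _, by simp⟩))

end List

/-! ### Corners, triangular faces and the cyclic order around a node. -/

namespace RotationSystem

variable {V : Type*} (R : RotationSystem V)

/-- The number of neighbors of `v`. -/
noncomputable def degree (v : V) : ℕ := (R.graph.neighborSet v).ncard

/-- `b` is the neighbor of `v` that follows the neighbor `a` in counterclockwise order. -/
def Follows (v a b : V) : Prop :=
  ∃ d : R.graph.Dart, d.fst = v ∧ d.snd = a ∧ (R.next d).snd = b

variable {R}

theorem dart_ext {d e : R.graph.Dart} (h : d.fst = e.fst) (h' : d.snd = e.snd) : d = e :=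
  SimpleGraph.Dart.ext _ _ (Prod.ext h h')

theorem prev_fst (d : R.graph.Dart) : (R.next⁻¹ d).fst = d.fst := by
  have := R.next_fst (R.next⁻¹ d)
  simpa using this.symm

theorem next_pow_fst (k : ℕ) (d : R.graph.Dart) : ((R.next ^ k) d).fst = d.fst := by
  induction k with
  | zero => rfl
  | succ k ih => rw [pow_succ', Equiv.Perm.mul_apply, R.next_fst, ih]

theorem Follows.adj_left {v a b : V} (h : R.Follows v a b) : R.graph.Adj v a := by
  obtain ⟨d, rfl, rfl, -⟩ := h
  exact d.adj

theorem Follows.adj_right {v a b : V} (h : R.Follows v a b) : R.graph.Adj v b := by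
  obtain ⟨d, rfl, -, rfl⟩ := h
  have := (R.next d).adj
  rwa [R.next_fst] at this

theorem Follows.next_eq {v a b : V} (h : R.Follows v a b) (d : R.graph.Dart) (hd : d.fst = v)
    (ha : d.snd = a) : (R.next d).snd = b := by
  obtain ⟨e, he, hea, rfl⟩ := h
  rw [dart_ext (d := d) (e := e) (by rw [hd, he]) (by rw [ha, hea])]

theorem Follows.prev_eq {v a b : V} (h : R.Follows v a b) (d : R.graph.Dart) (hd : d.fst = v)
    (hb : d.snd = b) : (R.next⁻¹ d).snd = a := by
  obtain ⟨e, he, hea, rfl⟩ := h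
  rw [dart_ext (d := d) (e := R.next e) (by rw [hd, R.next_fst, he]) hb]
  simpa using hea

theorem exists_follows_right {v a : V} (h : R.graph.Adj v a) : ∃ b, R.Follows v a b :=
  ⟨_, ⟨(v, a), h⟩, rfl, rfl, rfl⟩

theorem exists_follows_left {v b : V} (h : R.graph.Adj v b) : ∃ a, R.Follows v a b :=
  ⟨_, R.next⁻¹ ⟨(v, b), h⟩, prev_fst _, rfl, by simp⟩

/-- The three corners of a triangular face. -/
theorem Follows.rotate (h3 : ∀ d, R.facePerm (R.facePerm (R.facePerm d)) = d) {v a b : V}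
    (h : R.Follows v a b) : R.Follows a b v := by
  obtain ⟨d, rfl, rfl, rfl⟩ := h
  have key : R.facePerm (R.facePerm d) = (R.next d).symm := by
    have h1 := h3 d
    change R.next⁻¹ (R.facePerm (R.facePerm d)).symm = d at h1
    rw [Equiv.Perm.inv_eq_iff_eq] at h1
    rw [← h1, SimpleGraph.Dart.symm_symm]
  have h2 : (R.facePerm d).snd = (R.next d).snd := by
    have h4 : (R.facePerm (R.facePerm d)).fst = (R.facePerm d).snd :=
      prev_fst (R.facePerm d).symm
    rw [← h4, key]
    rfl
  refine ⟨R.facePerm d, prev_fst d.symm, h2, ?_⟩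
  change (R.next (R.next⁻¹ d.symm)).snd = _
  simp

theorem facePerm_fst (d : R.graph.Dart) : (R.facePerm d).fst = d.snd := prev_fst d.symm

/-- The cube of `facePerm` is the identity, so exponents matter only modulo 3. -/
theorem mem_face_iff (h3 : ∀ d, R.facePerm (R.facePerm (R.facePerm d)) = d)
    {d e : R.graph.Dart} : R.face d = R.face e ↔
      d = e ∨ d = R.facePerm e ∨ d = R.facePerm (R.facePerm e) := by
  have hcycle : R.face d = R.face e ↔ R.facePerm.SameCycle d e := Quotient.eq
  rw [hcycle]
  constructor
  · intro h
    obtain ⟨i, hi⟩ := h.symm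
    have hpow : R.facePerm ^ (3 : ℤ) = 1 := by
      ext1 x
      exact h3 x
    have h0 : 0 ≤ i % 3 := Int.emod_nonneg _ (by norm_num)
    have h3' : i % 3 < 3 := Int.emod_lt_of_pos _ (by norm_num)
    rw [← Int.emod_add_mul_ediv i 3, zpow_add, zpow_mul, hpow, one_zpow, mul_one] at hi
    obtain h | h | h : i % 3 = 0 ∨ i % 3 = 1 ∨ i % 3 = 2 := by omega
    · rw [h] at hi; exact .inl hi.symm
    · rw [h] at hi; exact .inr (.inl hi.symm)
    · rw [h] at hi; exact .inr (.inr hi.symm)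
  · rintro (rfl | rfl | rfl)
    · exact .rfl
    · exact Equiv.Perm.sameCycle_apply_left.mpr .rfl
    · exact Equiv.Perm.sameCycle_apply_left.mpr (Equiv.Perm.sameCycle_apply_left.mpr .rfl)

section Finite

variable [Finite V]

instance : Finite R.graph.Dart := Finite.of_injective _ SimpleGraph.Dart.toProd_injective

theorem exists_finset_isCycleOn (v : V) :
    ∃ s : Finset R.graph.Dart, (∀ d, d ∈ s ↔ d.fst = v) ∧ s.card = R.degree v ∧
      R.next.IsCycleOn s := by
  have hf : {d : R.graph.Dart | d.fst = v}.Finite := Set.toFinite _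
  refine ⟨hf.toFinset, by simp, ?_, ?_, ?_⟩
  · rw [← Set.ncard_eq_toFinset_card _ hf]
    refine Set.ncard_congr (fun d _ => d.snd) ?_ ?_ ?_
    · rintro d rfl
      exact d.adj
    · rintro d e rfl he h
      exact dart_ext he.symm h
    · intro w hw
      exact ⟨⟨(v, w), hw⟩, rfl, rfl⟩
  · rw [Set.Finite.coe_toFinset]
    refine ⟨fun d hd => (R.next_fst d).trans hd, R.next.injective.injOn, fun d hd =>
      ⟨R.next⁻¹ d, (prev_fst d).trans hd, by simp⟩⟩
  · intro d hd e he
    simp only [Set.Finite.coe_toFinset, Set.mem_ofPred_eq] at hd he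
    exact R.next_sameCycle d e (hd.trans he.symm)

theorem exists_next_pow_eq {d e : R.graph.Dart} (h : d.fst = e.fst) :
    ∃ k < R.degree d.fst, (R.next ^ k) d = e := by
  obtain ⟨s, hs, hc, hcyc⟩ := R.exists_finset_isCycleOn d.fst
  rw [← hc]
  exact hcyc.exists_pow_eq ((hs d).mpr rfl) ((hs e).mpr h.symm)

theorem next_pow_inj {d : R.graph.Dart} {i j : ℕ} (hi : i < R.degree d.fst)
    (hj : j < R.degree d.fst) (h : (R.next ^ i) d = (R.next ^ j) d) : i = j := by
  obtain ⟨s, hs, hc, hcyc⟩ := R.exists_finset_isCycleOn d.fst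
  have := (hcyc.pow_apply_eq_pow_apply ((hs d).mpr rfl)).mp h
  rw [hc] at this
  exact Nat.ModEq.eq_of_lt_of_lt this hi hj

theorem next_pow_degree (d : R.graph.Dart) : (R.next ^ R.degree d.fst) d = d := by
  obtain ⟨s, hs, hc, hcyc⟩ := R.exists_finset_isCycleOn d.fst
  rw [← hc]
  exact hcyc.pow_card_apply ((hs d).mpr rfl)

theorem degree_pos {v a : V} (h : R.graph.Adj v a) : 0 < R.degree v := by
  obtain ⟨k, hk, -⟩ := R.exists_next_pow_eq (d := ⟨(v, a), h⟩) (e := ⟨(v, a), h⟩) rfl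
  exact (Nat.zero_le k).trans_lt hk

end Finite

end RotationSystem

/-! ### The preordering as the lexicographic order of keys. -/

namespace PlaneGraph

/-- For each node of the tree, the dart from which a depth-first traversal scans its neighbors. -/
structure Tour {V : Type*} (M : PlaneGraph V) (T : RootedSubtree M.graph) where
  start : V → M.graph.Dart
  start_fst : ∀ v, (start v).fst = v
  prev_parent : ∀ v, v ≠ T.root → T.IsParent (M.next⁻¹ (start v)).snd v
  prev_outer : M.face (M.next⁻¹ (start T.root)) = M.outer
  spanning : T.tree.IsSpanning
  triangle : ∀ d, M.facePerm (M.facePerm (M.facePerm d)) = d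

variable {V : Type*} {M : PlaneGraph V} {T : RootedSubtree M.graph}

theorem exists_tour (hM : M.IsTriangulation) (hT : M.IsOrderlySpanningTree T) :
    Nonempty (M.Tour T) := by
  obtain ⟨hspan, ⟨d, hd, hdr⟩, -⟩ := hT
  have : ∀ v, ∃ e : M.graph.Dart, e.fst = v ∧
      (v ≠ T.root → T.IsParent (M.next⁻¹ e).snd v) ∧
      (v = T.root → M.face (M.next⁻¹ e) = M.outer) := by
    intro v
    by_cases hv : v = T.root
    · refine ⟨M.next d, by rw [M.next_fst, hdr, hv], fun h => absurd hv h, fun _ => ?_⟩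
      simpa using hd
    · obtain ⟨u, hu⟩ := T.exists_isParent (hspan v) hv
      refine ⟨M.next ⟨(v, u), hu.adj.symm⟩, M.next_fst _, fun _ => ?_, fun h => absurd h hv⟩
      simpa using hu
  choose start h1 h2 h3 using this
  exact ⟨⟨start, h1, h2, h3 _ rfl, hspan, hM.2⟩⟩

namespace Tour

variable (S : M.Tour T)

/-- The number of neighbors of `v` that are scanned before `w`. -/
noncomputable def pos (v w : V) : ℕ := sInf {k | ((M.next ^ k) (S.start v)).snd = w}

open Classical in
-- The value at a node without a parent is arbitrary; `key` climbs only `depth` many times and never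
-- uses it.
noncomputable def parent (_ : M.Tour T) (v : V) : V :=
  if h : ∃ u, T.IsParent u v then h.choose else v

theorem parent_eq {u v : V} (h : T.IsParent u v) : S.parent v = u := by
  have hex : ∃ u, T.IsParent u v := ⟨u, h⟩
  rw [parent, dif_pos hex]
  exact hex.choose_spec.unique h

theorem isParent_parent {v : V} (h : v ≠ T.root) : T.IsParent (S.parent v) v := by
  obtain ⟨u, hu⟩ := T.exists_isParent (S.spanning v) h
  rwa [S.parent_eq hu]

noncomputable def keyAux : ℕ → V → List ℕ
  | 0, _ => []
  | k + 1, v => keyAux k (S.parent v) ++ [S.pos (S.parent v) v]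

/-- The positions of the edges on the path from the root to `v`; the lexicographic order of these
sequences is the preordering of the tree. -/
noncomputable def key (v : V) : List ℕ := S.keyAux (T.depth v) v

theorem key_root : S.key T.root = [] := by simp [key, keyAux]

theorem key_eq {u v : V} (h : T.IsParent u v) : S.key v = S.key u ++ [S.pos u v] := by
  rw [key, h.2, keyAux, S.parent_eq h, key]

theorem length_key (v : V) : (S.key v).length = T.depth v := by
  have : ∀ k v, (S.keyAux k v).length = k := by
    intro k
    induction k with
    | zero => intro v; rfl
    | succ k ih => intro v; simp [keyAux, ih]
  exact this _ v

theorem key_eq_nil {v : V} : S.key v = [] ↔ v = T.root := by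
  constructor
  · intro h
    by_contra hv
    rw [S.key_eq (S.isParent_parent hv)] at h
    simp at h
  · rintro rfl
    exact S.key_root

theorem eq_root_or_isParent (S : M.Tour T) (v : V) : v = T.root ∨ ∃ u, T.IsParent u v :=
  (em (v = T.root)).imp_right fun h => ⟨_, S.isParent_parent h⟩

theorem isAncestor_root (S : M.Tour T) (v : V) : T.IsAncestor T.root v := by
  induction hk : T.depth v generalizing v with
  | zero =>
    rcases S.eq_root_or_isParent v with rfl | ⟨u, hu⟩
    · exact .refl
    · have := hu.2
      omega
  | succ k ih =>
    rcases S.eq_root_or_isParent v with rfl | ⟨u, hu⟩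
    · exact .refl
    · exact (ih u (by have := hu.2; omega)).tail hu

theorem exists_isAncestor_of_prefix {v : V} {q : List ℕ} (h : q <+: S.key v) :
    ∃ a, T.IsAncestor a v ∧ S.key a = q := by
  induction hk : T.depth v generalizing v with
  | zero =>
    rcases S.eq_root_or_isParent v with rfl | ⟨u, hu⟩
    · rw [S.key_root, List.prefix_nil] at h
      exact ⟨_, .refl, by rw [h, S.key_root]⟩
    · have := hu.2
      omega
  | succ k ih =>
    rcases S.eq_root_or_isParent v with rfl | ⟨u, hu⟩
    · simp at hk
    · rw [S.key_eq hu, List.prefix_concat_iff] at h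
      rcases h with rfl | h
      · exact ⟨v, .refl, S.key_eq hu⟩
      · obtain ⟨a, ha, hq⟩ := ih h (by have := hu.2; omega)
        exact ⟨a, ha.tail hu, hq⟩

/-- The contour is a triangle, so just one of its darts starts at the root and the external corner
there is unique. -/
theorem eq_start_of_outer {d : M.graph.Dart} (hd : d.fst = T.root)
    (h : M.face (M.next⁻¹ d) = M.outer) : d = S.start T.root := by
  rw [← S.prev_outer, RotationSystem.mem_face_iff S.triangle] at h
  have hfst : (M.next⁻¹ d).fst = T.root := by rw [RotationSystem.prev_fst, hd]
  have hfst' : (M.next⁻¹ (S.start T.root)).fst = T.root := by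
    rw [RotationSystem.prev_fst, S.start_fst]
  rcases h with h | h | h
  · simpa using h
  · have h1 : (M.next⁻¹ (S.start T.root)).snd = T.root := by
      rw [← RotationSystem.facePerm_fst, ← h, hfst]
    exact absurd (hfst'.trans h1.symm) (SimpleGraph.Dart.fst_ne_snd _)
  · have h1 := S.triangle (M.next⁻¹ (S.start T.root))
    rw [← h] at h1
    have h2 : (M.next⁻¹ d).snd = T.root := by
      rw [← RotationSystem.facePerm_fst, h1, hfst']
    exact absurd (hfst.trans h2.symm) (SimpleGraph.Dart.fst_ne_snd _)

variable [Finite V]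

theorem pos_spec {v w : V} (h : M.graph.Adj v w) :
    S.pos v w < M.degree v ∧ (M.next ^ S.pos v w) (S.start v) = ⟨(v, w), h⟩ := by
  obtain ⟨k, hk, he⟩ := M.exists_next_pow_eq (d := S.start v) (e := ⟨(v, w), h⟩) (S.start_fst v)
  rw [S.start_fst] at hk
  have hmem : k ∈ {k | ((M.next ^ k) (S.start v)).snd = w} := by simp [he]
  refine ⟨(Nat.sInf_le hmem).trans_lt hk, ?_⟩
  refine RotationSystem.dart_ext ?_ (Nat.sInf_mem ⟨k, hmem⟩)
  rw [M.next_pow_fst, S.start_fst]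

theorem pos_lt {v w : V} (h : M.graph.Adj v w) : S.pos v w < M.degree v := (S.pos_spec h).1

theorem pos_eq_of_snd {v w : V} {k : ℕ} (hk : k < M.degree v)
    (h : ((M.next ^ k) (S.start v)).snd = w) : S.pos v w = k := by
  have hadj : M.graph.Adj v w := by
    have := ((M.next ^ k) (S.start v)).adj
    rwa [M.next_pow_fst, S.start_fst, h] at this
  obtain ⟨h1, h2⟩ := S.pos_spec hadj
  refine M.next_pow_inj (d := S.start v) ?_ ?_ ?_
  · rwa [S.start_fst]
  · rwa [S.start_fst]
  · rw [h2]
    exact RotationSystem.dart_ext (by rw [M.next_pow_fst, S.start_fst]) h.symm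

theorem pos_injective {v a b : V} (ha : M.graph.Adj v a) (hb : M.graph.Adj v b)
    (h : S.pos v a = S.pos v b) : a = b := by
  have h1 := (S.pos_spec ha).2
  rw [h, (S.pos_spec hb).2] at h1
  exact congrArg (fun d : M.graph.Dart => d.snd) h1.symm

theorem pos_start (v : V) : S.pos v (S.start v).snd = 0 := by
  refine S.pos_eq_of_snd ?_ (by simp)
  have := (S.start v).adj
  rw [S.start_fst] at this
  exact M.degree_pos this

theorem pos_prev_start (v : V) : S.pos v (M.next⁻¹ (S.start v)).snd + 1 = M.degree v := by
  have h := M.next_pow_degree (S.start v)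
  have hadj := (S.start v).adj
  rw [S.start_fst] at h hadj
  have hpos := M.degree_pos hadj
  obtain ⟨k, hk⟩ := Nat.exists_eq_succ_of_ne_zero hpos.ne'
  rw [S.pos_eq_of_snd (k := k) (by omega), hk]
  rw [hk, Nat.succ_eq_add_one, pow_succ', Equiv.Perm.mul_apply, ← Equiv.Perm.eq_inv_iff_eq] at h
  rw [h]

theorem pos_of_follows {v a b : V} (h : M.Follows v a b) :
    (S.pos v a + 1 < M.degree v ∧ S.pos v b = S.pos v a + 1) ∨
      (S.pos v a + 1 = M.degree v ∧ b = (S.start v).snd) := by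
  obtain ⟨h1, h2⟩ := S.pos_spec h.adj_left
  have h3 := h.next_eq ((M.next ^ S.pos v a) (S.start v)) (by rw [h2]) (by rw [h2])
  rw [← Equiv.Perm.mul_apply, ← pow_succ'] at h3
  rcases Nat.lt_or_ge (S.pos v a + 1) (M.degree v) with h4 | h4
  · exact .inl ⟨h4, S.pos_eq_of_snd h4 h3⟩
  · have h5 : S.pos v a + 1 = M.degree v := by omega
    refine .inr ⟨h5, ?_⟩
    have h6 := M.next_pow_degree (S.start v)
    rw [S.start_fst] at h6
    rw [← h3, h5, h6]

/-- The list starts right after the parent, so the parent comes last. Thus the blocks do not wrap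
around, and cyclic comparisons become comparisons of positions. -/
theorem pos_parent {u v : V} (h : T.IsParent u v) : S.pos v u + 1 = M.degree v := by
  have hv : v ≠ T.root := by
    rintro rfl
    exact T.not_isParent_root _ h
  rw [h.unique (S.prev_parent v hv)]
  exact S.pos_prev_start v

theorem key_injective : Function.Injective S.key := by
  intro u v h
  induction hk : T.depth u generalizing u v with
  | zero =>
    rw [← S.length_key, List.length_eq_zero_iff] at hk
    exact (S.key_eq_nil.mp hk).trans (S.key_eq_nil.mp (h.symm.trans hk)).symm
  | succ k ih =>
    have hk' : T.depth v = k + 1 := by rw [← S.length_key, ← h, S.length_key, hk]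
    rcases S.eq_root_or_isParent u with rfl | ⟨p, hp⟩
    · simp at hk
    rcases S.eq_root_or_isParent v with rfl | ⟨q, hq⟩
    · simp at hk'
    rw [S.key_eq hp, S.key_eq hq] at h
    obtain ⟨h1, h2⟩ := List.append_inj' h rfl
    obtain rfl := ih h1 (by have := hp.2; omega)
    exact S.pos_injective hp.adj hq.adj (by simpa using h2)

theorem isAncestor_iff_prefix {u v : V} : T.IsAncestor u v ↔ S.key u <+: S.key v := by
  constructor
  · intro h
    induction h with
    | refl => exact List.prefix_rfl
    | tail _ h ih => rw [S.key_eq h]; exact ih.trans (List.prefix_append _ _)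
  · intro h
    obtain ⟨a, ha, hq⟩ := S.exists_isAncestor_of_prefix h
    rwa [← S.key_injective hq]

/-- Away from the root, `ChildBefore` counts from the dart to the parent, and `S.pos` from the dart
after it, so the indices differ by one; at the root they agree. -/
theorem childBefore_iff {p a b : V} :
    M.ChildBefore T p a b ↔ T.IsParent p a ∧ T.IsParent p b ∧ S.pos p a < S.pos p b := by
  constructor
  · rintro ⟨ha, hb, d, i, j, hd, hbase, hij, hj, hia, hjb⟩
    refine ⟨ha, hb, ?_⟩
    change j < M.degree p at hj
    rcases hbase with h | ⟨hr, ho⟩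
    · rw [hd] at h
      have hp : p ≠ T.root := by
        rintro rfl
        exact T.not_isParent_root _ h
      have hstart : S.start p = M.next d := by
        rw [← Equiv.Perm.inv_eq_iff_eq]
        refine RotationSystem.dart_ext ?_ ((S.prev_parent p hp).unique h)
        rw [RotationSystem.prev_fst, S.start_fst, hd]
      have key : ∀ (k : ℕ) (c : V), k < M.degree p → T.IsParent p c → ((M.next ^ k) d).snd = c →
          S.pos p c + 1 = k := by
        intro k c hk hc hkc
        cases k with
        | zero =>
          rw [← hkc] at hc
          exact absurd h hc.asymm
        | succ k =>
          rw [S.pos_eq_of_snd (k := k) (by omega)]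
          rw [hstart, ← Equiv.Perm.mul_apply, ← pow_succ, hkc]
      have h1 := key i a (hij.trans hj) ha hia
      have h2 := key j b hj hb hjb
      omega
    · obtain rfl := S.eq_start_of_outer hr ho
      rw [S.start_fst] at hd
      subst hd
      rw [S.pos_eq_of_snd (hij.trans hj) hia, S.pos_eq_of_snd hj hjb]
      exact hij
  · rintro ⟨ha, hb, hlt⟩
    obtain ⟨h1, h2⟩ := S.pos_spec ha.adj
    obtain ⟨h3, h4⟩ := S.pos_spec hb.adj
    refine ⟨ha, hb, ?_⟩
    by_cases hp : p = T.root
    · subst hp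
      refine ⟨S.start T.root, S.pos T.root a, S.pos T.root b, S.start_fst _,
        .inr ⟨S.start_fst _, S.prev_outer⟩, hlt, h3, by rw [h2], by rw [h4]⟩
    · have hpar := S.prev_parent p hp
      have h5 := S.pos_parent hpar
      have h6 : S.pos p b ≠ S.pos p (M.next⁻¹ (S.start p)).snd := by
        intro h
        have := S.pos_injective hb.adj hpar.adj.symm h
        rw [← this] at hpar
        exact hpar.asymm hb
      change S.pos p a < M.degree p at h1
      refine ⟨M.next⁻¹ (S.start p), S.pos p a + 1, S.pos p b + 1, ?_, .inl ?_, by omega, ?_, ?_, ?_⟩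
      · rw [RotationSystem.prev_fst, S.start_fst]
      · rwa [RotationSystem.prev_fst, S.start_fst]
      · change _ < M.degree p
        omega
      · rw [pow_succ, Equiv.Perm.mul_apply, ← Equiv.Perm.mul_apply M.next, mul_inv_cancel,
          Equiv.Perm.one_apply, h2]
      · rw [pow_succ, Equiv.Perm.mul_apply, ← Equiv.Perm.mul_apply M.next, mul_inv_cancel,
          Equiv.Perm.one_apply, h4]

/-- The two clauses of `Precedes` are the two ways to be lexicographically smaller: a proper prefix,
or a smaller entry at the first difference. In the second case the common prefix is the key of the
node `p` where the paths branch. -/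
theorem precedes_iff {x y : V} : M.Precedes T x y ↔ S.key x < S.key y := by
  rw [List.lt_iff_exists_prefix]
  constructor
  · rintro (⟨hne, h⟩ | ⟨p, a, b, h, hax, hby⟩)
    · exact .inl ⟨S.isAncestor_iff_prefix.mp h, S.key_injective.ne hne⟩
    · obtain ⟨ha, hb, hlt⟩ := S.childBefore_iff.mp h
      obtain ⟨r, hr⟩ := S.isAncestor_iff_prefix.mp hax
      obtain ⟨s, hs⟩ := S.isAncestor_iff_prefix.mp hby
      rw [S.key_eq ha] at hr
      rw [S.key_eq hb] at hs
      exact .inr ⟨S.key p, _, _, r, s, by rw [← hr]; simp, by rw [← hs]; simp, hlt⟩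
  · rintro (⟨h, hne⟩ | ⟨q, i, j, r, s, hx, hy, hij⟩)
    · exact .inl ⟨fun h => hne (h ▸ rfl), S.isAncestor_iff_prefix.mpr h⟩
    · obtain ⟨a, ha, hqa⟩ := S.exists_isAncestor_of_prefix (v := x) (q := q ++ [i])
        ⟨r, by simp [hx]⟩
      obtain ⟨b, hb, hqb⟩ := S.exists_isAncestor_of_prefix (v := y) (q := q ++ [j])
        ⟨s, by simp [hy]⟩
      rcases S.eq_root_or_isParent a with rfl | ⟨p, hp⟩
      · simp [S.key_root] at hqa
      rcases S.eq_root_or_isParent b with rfl | ⟨p', hp'⟩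
      · simp [S.key_root] at hqb
      rw [S.key_eq hp] at hqa
      rw [S.key_eq hp'] at hqb
      obtain ⟨h1, h2⟩ := List.append_inj' hqa rfl
      obtain ⟨h3, h4⟩ := List.append_inj' hqb rfl
      obtain rfl := S.key_injective (h1.trans h3.symm)
      refine .inr ⟨p, a, b, S.childBefore_iff.mpr ⟨hp, hp', ?_⟩, ha, hb⟩
      simp only [List.cons.injEq, and_true] at h2 h4
      omega

end Tour

end PlaneGraph

/-! ### Orderly nodes in terms of positions. -/

namespace PlaneGraph.Tour

variable {V : Type*} {M : PlaneGraph V} {T : RootedSubtree M.graph} [Finite V] (S : M.Tour T)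

set_option linter.unusedSectionVars false

include S

theorem key_lt_of_isParent {u v : V} (h : T.IsParent u v) : S.key u < S.key v := by
  rw [S.key_eq h, List.lt_iff_exists_prefix]
  exact .inl ⟨List.prefix_append _ _, by simp⟩

theorem mem_B₂_iff {u v : V} :
    u ∈ M.B₂ T v ↔ M.graph.Adj v u ∧ S.key u < S.key v ∧ ¬ S.key u <+: S.key v := by
  change (_ ∧ _ ∧ _) ↔ _
  rw [S.precedes_iff, RootedSubtree.Unrelated, S.isAncestor_iff_prefix, S.isAncestor_iff_prefix]
  constructor
  · rintro ⟨h1, ⟨h2, -⟩, h3⟩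
    exact ⟨h1, h3, h2⟩
  · rintro ⟨h1, h3, h2⟩
    refine ⟨h1, ⟨h2, fun h => ?_⟩, h3⟩
    refine lt_asymm h3 (List.lt_iff_exists_prefix.mpr (.inl ⟨h, fun e => ?_⟩))
    rw [e] at h3
    exact lt_irrefl _ h3

/-- This symmetry allows everything below to be phrased with B₂ alone. -/
theorem mem_B₄_iff {u v : V} : u ∈ M.B₄ T v ↔ v ∈ M.B₂ T u := by
  constructor
  · rintro ⟨h1, ⟨h2, h3⟩, h4⟩
    exact ⟨h1.symm, ⟨h3, h2⟩, h4⟩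
  · rintro ⟨h1, ⟨h2, h3⟩, h4⟩
    exact ⟨h1.symm, ⟨h3, h2⟩, h4⟩

theorem key_lt_of_mem_B₂ {u v : V} (h : u ∈ M.B₂ T v) : S.key u < S.key v :=
  (S.mem_B₂_iff.mp h).2.1

theorem not_isParent_of_mem_B₂ {u v : V} (h : u ∈ M.B₂ T v) : ¬ T.IsParent u v :=
  fun h' => h.2.1.1 (.single h')

theorem not_isParent_of_mem_B₂' {u v : V} (h : u ∈ M.B₂ T v) : ¬ T.IsParent v u :=
  fun h' => h.2.1.2 (.single h')

/-- The descendants of `u` precede each later node that is unrelated to `u`. -/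
theorem child_key_lt {u v x : V} (h : u ∈ M.B₂ T v) (hx : T.IsParent u x) :
    S.key x < S.key v := by
  obtain ⟨-, h2, h3⟩ := S.mem_B₂_iff.mp h
  have := List.append_lt_append_of_not_prefix h2 h3 [S.pos u x] []
  rwa [← S.key_eq hx, List.append_nil] at this

theorem pos_lt_iff_of_isParent {p u v : V} (hu : T.IsParent p u) (hv : T.IsParent p v) :
    S.key u < S.key v ↔ S.pos p u < S.pos p v := by
  rw [S.key_eq hu, S.key_eq hv, List.append_lt_append_left_iff]
  simp [List.cons_lt_cons_iff]

theorem eq_parent_of_pos {v u : V} (hv : v ≠ T.root) (hu : M.graph.Adj v u)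
    (h : S.pos v u + 1 = M.degree v) : T.IsParent u v := by
  have h1 := S.prev_parent v hv
  have h2 := S.pos_parent h1
  have h3 := S.pos_injective hu h1.adj.symm (by omega)
  rwa [h3]

theorem pos_add_one_lt {v u : V} (hv : v ≠ T.root) (hu : M.graph.Adj v u)
    (h : ¬ T.IsParent u v) : S.pos v u + 1 < M.degree v := by
  have h1 := S.pos_lt hu
  have h2 : S.pos v u + 1 ≠ M.degree v := fun h' => h (S.eq_parent_of_pos hv hu h')
  omega

variable (ho : ∀ v, M.IsOrderlyNode T v)

include ho

theorem kind {v w : V} (h : M.graph.Adj v w) :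
    T.IsParent w v ∨ w ∈ M.B₂ T v ∨ T.IsParent v w ∨ v ∈ M.B₂ T w := by
  obtain ⟨d, label, hd, -, hl⟩ := ho v
  obtain ⟨k, hk, he⟩ := M.exists_next_pow_eq (d := d) (e := ⟨(v, w), h⟩) hd
  rw [hd] at hk
  have h1 := hl k hk (label k)
  rw [he] at h1
  have h2 := h1.mpr rfl
  obtain h3 | h3 | h3 | h3 : label k = 0 ∨ label k = 1 ∨ label k = 2 ∨ label k = 3 := by
    generalize label k = x
    revert x
    decide
  · rw [h3] at h2; exact .inl h2
  · rw [h3] at h2; exact .inr (.inl h2)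
  · rw [h3] at h2; exact .inr (.inr (.inl h2))
  · rw [h3] at h2; exact .inr (.inr (.inr (S.mem_B₄_iff.mp h2)))

/-- The parent has label 0, so by monotonicity the first label of the given list is 0 as well, and
that list starts at the parent. Shifting by one gives labels from `S.start`; the parent, moved to
the end, has to be excepted. -/
theorem exists_label {v : V} (hv : v ≠ T.root) :
    ∃ label : ℕ → Fin 4, Monotone label ∧ ∀ w, M.graph.Adj v w → ¬ T.IsParent w v →
      ∀ a, w ∈ (![M.B₁ T v, M.B₂ T v, M.B₃ T v, M.B₄ T v] : Fin 4 → Set V) a ↔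
        label (S.pos v w) = a := by
  obtain ⟨d, label, hd, hmono, hl⟩ := ho v
  change ∀ k < M.degree v, _ at hl
  have hpar := S.prev_parent v hv
  obtain ⟨k, hk, he⟩ := M.exists_next_pow_eq (d := d) (e := M.next⁻¹ (S.start v))
    (by rw [hd, RotationSystem.prev_fst, S.start_fst])
  rw [hd] at hk
  have h0 : label k = 0 := (hl k hk 0).mp (by rw [he]; exact hpar)
  have h0' : label 0 = 0 := le_antisymm (h0 ▸ hmono (Nat.zero_le k)) (Fin.zero_le _)
  have h1 : T.IsParent d.snd v := (hl 0 (by omega) 0).mpr h0'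
  have h2 : d = M.next⁻¹ (S.start v) :=
    RotationSystem.dart_ext (by rw [hd, RotationSystem.prev_fst, S.start_fst]) (h1.unique hpar)
  have h3 : S.start v = M.next d := by rw [h2, ← Equiv.Perm.mul_apply]; simp
  refine ⟨fun k => label (k + 1), fun a b h => hmono (by omega), fun w hw hwp a => ?_⟩
  obtain ⟨h4, h5⟩ := S.pos_spec hw
  have h6 := S.pos_parent hpar
  have h7 : S.pos v w ≠ S.pos v (M.next⁻¹ (S.start v)).snd := fun h => by
    rw [S.pos_injective hw hpar.adj.symm h] at hwp
    exact hwp hpar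
  rw [← hl _ (by omega) a, pow_succ, Equiv.Perm.mul_apply, ← h3, h5]

/-- B₂ is an initial segment of the positions. Dually, by `mem_B₄_of_pos_le`, B₄ is a final segment
of the positions before the parent. -/
theorem mem_B₂_of_pos_le {v a b : V} (ha : M.graph.Adj v a) (hap : ¬ T.IsParent a v)
    (hb : b ∈ M.B₂ T v) (h : S.pos v a ≤ S.pos v b) : a ∈ M.B₂ T v := by
  have hv : v ≠ T.root := by
    rintro rfl
    exact hb.2.1.2 (S.isAncestor_root _)
  obtain ⟨label, hmono, hl⟩ := S.exists_label ho hv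
  have h1 : label (S.pos v b) = 1 := (hl b hb.1 (S.not_isParent_of_mem_B₂ hb) 1).mp hb
  have h2 := hmono h
  have h3 := (hl a ha hap _).mpr rfl
  obtain h4 | h4 : label (S.pos v a) = 0 ∨ label (S.pos v a) = 1 := by
    rw [h1] at h2
    revert h2
    generalize label (S.pos v a) = x
    revert x
    decide
  · rw [h4] at h3; exact absurd h3 hap
  · rw [h4] at h3; exact h3

theorem mem_B₄_of_pos_le {v a b : V} (ha : v ∈ M.B₂ T a) (hb : M.graph.Adj v b)
    (hbp : ¬ T.IsParent b v) (h : S.pos v a ≤ S.pos v b) : v ∈ M.B₂ T b := by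
  have hv : v ≠ T.root := by
    rintro rfl
    exact ha.2.1.1 (S.isAncestor_root _)
  obtain ⟨label, hmono, hl⟩ := S.exists_label ho hv
  have h1 : label (S.pos v a) = 3 :=
    (hl a ha.1.symm (S.not_isParent_of_mem_B₂' ha) 3).mp (S.mem_B₄_iff.mpr ha)
  have h2 := hmono h
  exact S.mem_B₄_iff.mp ((hl b hb hbp 3).mpr (le_antisymm (Fin.le_last _) (h1 ▸ h2)))

/-- The four blocks leave no room for an edge between a node and an ancestor other than its parent.
-/
theorem isParent_of_isAncestor {u v : V} (h : M.graph.Adj u v) (ha : T.IsAncestor u v) :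
    T.IsParent u v := by
  rcases S.kind ho h with h1 | h1 | h1 | h1
  · have h2 := S.key_lt_of_isParent h1
    have h3 := S.isAncestor_iff_prefix.mp ha
    have h4 := h3.length_le
    rw [S.length_key, S.length_key] at h4
    have := h1.2
    omega
  · exact absurd ha h1.2.1.2
  · exact h1
  · exact absurd ha h1.2.1.1

theorem isParent_root {v : V} (h : M.graph.Adj T.root v) : T.IsParent T.root v :=
  S.isParent_of_isAncestor ho h (S.isAncestor_root v)

/-! ### The contour: the root with its first and last child. -/

omit ho S

/-- The first child of the root. -/
def first : V := (S.start T.root).snd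

/-- The last child of the root. -/
def last : V := (M.next⁻¹ (S.start T.root)).snd

include S

theorem follows_root : M.Follows T.root S.last S.first :=
  ⟨_, (RotationSystem.prev_fst _).trans (S.start_fst _), rfl, by
    rw [← Equiv.Perm.mul_apply]; simp [first]⟩

theorem follows_last : M.Follows S.last S.first T.root := S.follows_root.rotate S.triangle

theorem follows_first : M.Follows S.first T.root S.last := S.follows_last.rotate S.triangle

theorem first_ne_last : S.first ≠ S.last := S.follows_last.adj_left.ne'

include ho

theorem isParent_first : T.IsParent T.root S.first := S.isParent_root ho S.follows_root.adj_right

theorem isParent_last : T.IsParent T.root S.last := S.isParent_root ho S.follows_root.adj_left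

theorem first_ne_root : S.first ≠ T.root := (S.isParent_first ho).ne.symm

theorem last_ne_root : S.last ≠ T.root := (S.isParent_last ho).ne.symm

theorem first_mem_B₂_last : S.first ∈ M.B₂ T S.last := by
  have h1 := S.isParent_first ho
  have h2 := S.isParent_last ho
  have h3 : S.key S.first < S.key S.last := by
    rw [S.pos_lt_iff_of_isParent h1 h2, first, S.pos_start, Nat.pos_iff_ne_zero]
    intro h
    exact S.first_ne_last (S.pos_injective h1.adj h2.adj (by rw [h, first, S.pos_start]))
  refine S.mem_B₂_iff.mpr ⟨S.follows_last.adj_left, h3, fun h => ?_⟩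
  have := h.eq_of_length (by rw [S.length_key, S.length_key, h1.2, h2.2])
  rw [this] at h3
  exact lt_irrefl _ h3

/-- By the external triangle, `S.first` comes immediately before the root around `S.last`. It
belongs to B₂ and has the last position before the parent, so B₂ fills all the earlier positions. In
particular `S.last` is a leaf. The mirror image for `S.first` is `mem_B₄_first`. -/
theorem mem_B₂_last {w : V} (h : M.graph.Adj S.last w) (hw : w ≠ T.root) :
    w ∈ M.B₂ T S.last := by
  have hp := S.isParent_last ho
  have hwp : ¬ T.IsParent w S.last := fun h' => hw (h'.unique hp)
  refine S.mem_B₂_of_pos_le ho h hwp (S.first_mem_B₂_last ho) ?_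
  have h1 := S.pos_add_one_lt (S.last_ne_root ho) h hwp
  have h2 := S.pos_parent hp
  rcases S.pos_of_follows S.follows_last with h3 | h3
  · omega
  · exact absurd (S.pos_injective S.follows_last.adj_left hp.adj.symm (by omega))
      (S.first_ne_root ho)

theorem mem_B₄_first {w : V} (h : M.graph.Adj S.first w) (hw : w ≠ T.root) :
    S.first ∈ M.B₂ T w := by
  have hp := S.isParent_first ho
  have hwp : ¬ T.IsParent w S.first := fun h' => hw (h'.unique hp)
  refine S.mem_B₄_of_pos_le ho (S.first_mem_B₂_last ho) h hwp ?_
  have h2 := S.pos_parent hp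
  rcases S.pos_of_follows S.follows_first with h3 | h3
  · omega
  · rw [h3.2, S.pos_start]
    exact Nat.zero_le _

theorem not_isParent_last (w : V) : ¬ T.IsParent S.last w := fun h =>
  S.not_isParent_of_mem_B₂'
    (S.mem_B₂_last ho h.adj fun e => T.not_isParent_root _ (e ▸ h)) h

theorem not_isParent_first (w : V) : ¬ T.IsParent S.first w := fun h =>
  S.not_isParent_of_mem_B₂
    (S.mem_B₄_first ho h.adj fun e => T.not_isParent_root _ (e ▸ h)) h

omit ho in
theorem exists_child_root {u : V} (hu : u ≠ T.root) :
    ∃ a, T.IsParent T.root a ∧ T.IsAncestor a u := by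
  rcases Relation.ReflTransGen.cases_head (S.isAncestor_root u) with h | ⟨a, h1, h2⟩
  · exact absurd h.symm hu
  · exact ⟨a, h1, h2⟩

omit ho in
theorem key_lt_of_isAncestor {u v : V} (h : T.IsAncestor u v) (hne : u ≠ v) :
    S.key u < S.key v :=
  List.lt_iff_exists_prefix.mpr
    (.inl ⟨S.isAncestor_iff_prefix.mp h, S.key_injective.ne hne⟩)

theorem key_first_lt {u : V} (hu : u ≠ T.root) (hf : u ≠ S.first) : S.key S.first < S.key u := by
  obtain ⟨a, ha, hau⟩ := S.exists_child_root hu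
  by_cases h : a = S.first
  · exact S.key_lt_of_isAncestor (h ▸ hau) hf.symm
  · have h1 : S.key S.first < S.key a := by
      rw [S.pos_lt_iff_of_isParent (S.isParent_first ho) ha, first, S.pos_start,
        Nat.pos_iff_ne_zero]
      intro h0
      exact h (S.pos_injective ha.adj (S.isParent_first ho).adj (by rw [h0, first, S.pos_start]))
    by_cases h2 : a = u
    · exact h2 ▸ h1
    · exact h1.trans (S.key_lt_of_isAncestor hau h2)

/-- The subtrees at the other children of the root come earlier, and the subtree at `S.last` is that
node alone. -/
theorem key_lt_last {u : V} (hz : u ≠ S.last) : S.key u < S.key S.last := by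
  by_cases hu : u = T.root
  · exact hu ▸ S.key_lt_of_isParent (S.isParent_last ho)
  obtain ⟨a, ha, hau⟩ := S.exists_child_root hu
  by_cases h : a = S.last
  · rw [h] at hau
    rcases Relation.ReflTransGen.cases_head hau with h1 | ⟨b, h1, -⟩
    · exact absurd h1.symm hz
    · exact absurd h1 (S.not_isParent_last ho b)
  · have hl := S.isParent_last ho
    have h1 : S.key a < S.key S.last := by
      rw [S.pos_lt_iff_of_isParent ha hl]
      have h2 := S.pos_lt ha.adj
      have h3 := S.pos_prev_start T.root
      have h4 : S.pos T.root a ≠ S.pos T.root S.last :=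
        fun h' => h (S.pos_injective ha.adj hl.adj h')
      unfold last at h4 ⊢
      omega
    obtain ⟨h5, h6⟩ : S.key a < S.key S.last ∧ ¬ S.key a <+: S.key S.last := by
      refine ⟨h1, fun h' => ?_⟩
      have := h'.eq_of_length (by rw [S.length_key, S.length_key, ha.2, hl.2])
      exact h (S.key_injective this)
    obtain ⟨r, hr⟩ := S.isAncestor_iff_prefix.mp hau
    have := List.append_lt_append_of_not_prefix h5 h6 r []
    rwa [hr, List.append_nil] at this

omit ho in
theorem isExternalNode_iff {v : V} :
    M.IsExternalNode v ↔ v = T.root ∨ v = S.first ∨ v = S.last := by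
  have h0 : (M.next⁻¹ (S.start T.root)).fst = T.root :=
    (RotationSystem.prev_fst _).trans (S.start_fst _)
  have h1 : (M.facePerm (M.next⁻¹ (S.start T.root))).fst = S.last :=
    RotationSystem.facePerm_fst _
  have h2 : (M.facePerm (M.facePerm (M.next⁻¹ (S.start T.root)))).fst = S.first := by
    rw [RotationSystem.facePerm_fst]
    exact S.follows_last.prev_eq _ rfl h0
  constructor
  · rintro ⟨d, hd, rfl⟩
    rw [← S.prev_outer, RotationSystem.mem_face_iff S.triangle] at hd
    rcases hd with rfl | rfl | rfl
    · exact .inl h0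
    · exact .inr (.inr h1)
    · exact .inr (.inl h2)
  · rintro (rfl | rfl | rfl)
    · exact ⟨_, S.prev_outer, h0⟩
    · refine ⟨_, ?_, h2⟩
      rw [← S.prev_outer, RotationSystem.mem_face_iff S.triangle]
      exact .inr (.inr rfl)
    · refine ⟨_, ?_, h1⟩
      rw [← S.prev_outer, RotationSystem.mem_face_iff S.triangle]
      exact .inr (.inl rfl)

omit ho in
theorem externalEdges_eq :
    M.externalEdges = {s(T.root, S.last), s(S.last, S.first), s(S.first, T.root)} := by
  have h0 : (M.next⁻¹ (S.start T.root)).fst = T.root :=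
    (RotationSystem.prev_fst _).trans (S.start_fst _)
  have h1 : (M.facePerm (M.next⁻¹ (S.start T.root))).fst = S.last :=
    RotationSystem.facePerm_fst _
  have h1' : (M.facePerm (M.next⁻¹ (S.start T.root))).snd = S.first :=
    S.follows_last.prev_eq _ rfl h0
  have h2 : (M.facePerm (M.facePerm (M.next⁻¹ (S.start T.root)))).fst = S.first := by
    rw [RotationSystem.facePerm_fst, h1']
  have h2' : (M.facePerm (M.facePerm (M.next⁻¹ (S.start T.root)))).snd = T.root :=
    S.follows_first.prev_eq _ h1' h1
  have key : ∀ d : M.graph.Dart, d.edge = s(d.fst, d.snd) := fun d => rfl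
  ext e
  constructor
  · rintro ⟨d, hd, rfl⟩
    rw [← S.prev_outer, RotationSystem.mem_face_iff S.triangle] at hd
    rcases hd with rfl | rfl | rfl
    · left
      rw [key, h0]
      rfl
    · right; left
      rw [key, h1, h1']
    · right; right
      rw [key, h2, h2']
      rfl
  · rintro (rfl | rfl | rfl)
    · exact ⟨_, S.prev_outer, by rw [key, h0]; rfl⟩
    · refine ⟨_, ?_, by rw [key, h1, h1']⟩
      rw [← S.prev_outer, RotationSystem.mem_face_iff S.triangle]
      exact .inr (.inl rfl)
    · refine ⟨_, ?_, by rw [key, h2, h2']⟩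
      rw [← S.prev_outer, RotationSystem.mem_face_iff S.triangle]
      exact .inr (.inr rfl)

/-! ### Existence and uniqueness of the new parents. -/

/-- The neighbor after the parent precedes `v`. -/
theorem mem_B₂_of_follows_parent {v p u : V} (hp : T.IsParent p v) (hf : v ≠ S.first)
    (h : M.Follows v p u) : u ∈ M.B₂ T v := by
  have h' := h.rotate S.triangle
  have hpu := h'.adj_left
  rcases S.kind ho h.adj_right with h1 | h1 | h1 | h1
  · exact absurd (h1.unique hp) hpu.ne'
  · exact h1
  · have h2 := S.isParent_of_isAncestor ho hpu ((Relation.ReflTransGen.single hp).tail h1)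
    exact absurd (h2.unique h1) hp.ne
  · exfalso
    have hlt := S.key_lt_of_mem_B₂ h1
    have hanc : ¬ T.IsParent u p := fun h2 =>
      h1.2.1.2 ((Relation.ReflTransGen.single h2).tail hp)
    -- Suppose that `u` succeeds `v`. Around `p`, the node `u` comes immediately before `v`. Without
    -- a wrap, each block of `p` that may contain `u` contradicts the preordering or puts its child
    -- `v` into B₄(p). With a wrap, `u` would be the parent of `p`, unless `p` is the root and `v`
    -- its first child.
    rcases S.pos_of_follows h' with ⟨-, h2⟩ | ⟨h2, h3⟩
    · rcases S.kind ho hpu with h3 | h3 | h3 | h3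
      · exact hanc h3
      · exact lt_asymm hlt ((S.key_lt_of_mem_B₂ h3).trans (S.key_lt_of_isParent hp))
      · rw [S.pos_lt_iff_of_isParent hp h3] at hlt
        omega
      · exact S.not_isParent_of_mem_B₂
          (S.mem_B₄_of_pos_le ho h3 hp.adj hp.asymm (by omega)) hp
    · by_cases hr : p = T.root
      · subst hr
        exact hf h3
      · exact hanc (S.eq_parent_of_pos hr hpu h2)

/-- The neighbor before the parent succeeds `v`. -/
theorem mem_B₄_of_follows_parent {v p u : V} (hp : T.IsParent p v) (hz : v ≠ S.last)
    (h : M.Follows v u p) : v ∈ M.B₂ T u := by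
  have h' := (h.rotate S.triangle).rotate S.triangle
  have hpu := h'.adj_right
  rcases S.kind ho h.adj_left with h1 | h1 | h1 | h1
  · exact absurd (h1.unique hp) hpu.ne'
  · exfalso
    have hlt := S.key_lt_of_mem_B₂ h1
    have hanc : ¬ T.IsParent u p := fun h2 =>
      h1.2.1.1 ((Relation.ReflTransGen.single h2).tail hp)
    rcases S.pos_of_follows h' with ⟨-, h2⟩ | ⟨h2, h3⟩
    · rcases S.kind ho hpu with h3 | h3 | h3 | h3
      · exact hanc h3
      · exact S.not_isParent_of_mem_B₂'
          (S.mem_B₂_of_pos_le ho hp.adj hp.asymm h3 (by omega)) hp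
      · rw [S.pos_lt_iff_of_isParent h3 hp] at hlt
        omega
      · exact lt_asymm hlt (S.child_key_lt h3 hp)
    · by_cases hr : p = T.root
      · subst hr
        refine hz (S.pos_injective hp.adj (S.isParent_last ho).adj ?_)
        have := S.pos_prev_start T.root
        unfold last
        omega
      · exact hp.asymm (S.eq_parent_of_pos hr hp.adj h2)
  · have h2 := S.isParent_of_isAncestor ho hpu ((Relation.ReflTransGen.single hp).tail h1)
    exact absurd (h2.unique h1) hp.ne
  · exact h1

omit ho in
theorem ne_root_of_mem_B₂ {u v : V} (h : u ∈ M.B₂ T v) : v ≠ T.root := by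
  rintro rfl
  exact h.2.1.2 (S.isAncestor_root _)

omit ho in
theorem ne_root_of_mem_B₂' {u v : V} (h : u ∈ M.B₂ T v) : u ≠ T.root := by
  rintro rfl
  exact h.2.1.1 (S.isAncestor_root _)

theorem isLastInBlock_iff {v w : V} :
    M.IsLastInBlock v (M.B₂ T v) w ↔
      w ∈ M.B₂ T v ∧ ∀ x ∈ M.B₂ T v, S.pos v x ≤ S.pos v w := by
  constructor
  · rintro ⟨d, rfl, rfl, hw, hx⟩
    refine ⟨hw, fun y hy => ?_⟩
    by_contra! hlt
    have hv := S.ne_root_of_mem_B₂ hw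
    have hF : M.Follows d.fst d.snd (M.next d).snd := ⟨d, rfl, rfl, rfl⟩
    have h1 := S.pos_add_one_lt hv hw.1 (S.not_isParent_of_mem_B₂ hw)
    have h2 := S.pos_add_one_lt hv hy.1 (S.not_isParent_of_mem_B₂ hy)
    rcases S.pos_of_follows hF with ⟨-, h3⟩ | ⟨h3, -⟩
    · refine hx (S.mem_B₂_of_pos_le ho hF.adj_right (fun h => ?_) hy (by omega))
      have := S.pos_parent h
      omega
    · omega
  · rintro ⟨hw, hmax⟩
    refine ⟨⟨(v, w), hw.1⟩, rfl, rfl, hw, fun hx => ?_⟩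
    have hF : M.Follows v w (M.next ⟨(v, w), hw.1⟩).snd := ⟨_, rfl, rfl, rfl⟩
    have h1 := S.pos_add_one_lt (S.ne_root_of_mem_B₂ hw) hw.1 (S.not_isParent_of_mem_B₂ hw)
    have h2 := hmax _ hx
    rcases S.pos_of_follows hF with ⟨-, h3⟩ | ⟨h3, -⟩
    · omega
    · omega

theorem isFirstInBlock_iff {v w : V} :
    M.IsFirstInBlock v (M.B₄ T v) w ↔
      v ∈ M.B₂ T w ∧ ∀ x, v ∈ M.B₂ T x → S.pos v w ≤ S.pos v x := by
  constructor
  · rintro ⟨d, rfl, rfl, hw, hx⟩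
    rw [S.mem_B₄_iff] at hw hx
    refine ⟨hw, fun y hy => ?_⟩
    by_contra! hlt
    have hv := S.ne_root_of_mem_B₂' hw
    have hF : M.Follows d.fst (M.next⁻¹ d).snd d.snd :=
      ⟨M.next⁻¹ d, RotationSystem.prev_fst d, rfl, by rw [← Equiv.Perm.mul_apply]; simp⟩
    rcases S.pos_of_follows hF with ⟨h2, h3⟩ | ⟨h3, h4⟩
    · refine hx (S.mem_B₄_of_pos_le ho hy hF.adj_left (fun h => ?_) (by omega))
      have := S.pos_parent h
      omega
    · rw [h4, S.pos_start] at hlt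
      omega
  · rintro ⟨hw, hmin⟩
    refine ⟨⟨(v, w), hw.1.symm⟩, rfl, rfl, S.mem_B₄_iff.mpr hw, fun hx => ?_⟩
    rw [S.mem_B₄_iff] at hx
    have hF : M.Follows v (M.next⁻¹ ⟨(v, w), hw.1.symm⟩).snd w :=
      ⟨_, RotationSystem.prev_fst _, rfl, by rw [← Equiv.Perm.mul_apply]; simp⟩
    have h2 := hmin _ hx
    have h1 := S.pos_add_one_lt (S.ne_root_of_mem_B₂' hw) hF.adj_left
      (S.not_isParent_of_mem_B₂' hx)
    rcases S.pos_of_follows hF with ⟨-, h3⟩ | ⟨h3, -⟩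
    · omega
    · omega

/-- B₂ contains the neighbor right after the parent, so it has an element of greatest position. -/
theorem exists_isLastInBlock {v : V} (hr : v ≠ T.root) (hf : v ≠ S.first) :
    ∃ w, M.IsLastInBlock v (M.B₂ T v) w := by
  have hne : (M.B₂ T v).Nonempty := by
    have hp := S.prev_parent v hr
    obtain ⟨u, hu⟩ := M.exists_follows_right hp.adj.symm
    exact ⟨u, S.mem_B₂_of_follows_parent ho hp hf hu⟩
  obtain ⟨w, hw, hmax⟩ := Set.exists_max_image (M.B₂ T v) (S.pos v) (Set.toFinite _) hne
  exact ⟨w, (S.isLastInBlock_iff ho).mpr ⟨hw, hmax⟩⟩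

theorem exists_isFirstInBlock {v : V} (hr : v ≠ T.root) (hz : v ≠ S.last) :
    ∃ w, M.IsFirstInBlock v (M.B₄ T v) w := by
  have hne : {x | v ∈ M.B₂ T x}.Nonempty := by
    have hp := S.prev_parent v hr
    obtain ⟨u, hu⟩ := M.exists_follows_left hp.adj.symm
    exact ⟨u, S.mem_B₄_of_follows_parent ho hp hz hu⟩
  obtain ⟨w, hw, hmin⟩ := Set.exists_min_image {x | v ∈ M.B₂ T x} (S.pos v) (Set.toFinite _) hne
  exact ⟨w, (S.isFirstInBlock_iff ho).mpr ⟨hw, hmin⟩⟩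

theorem isLastInBlock_unique {v w w' : V} (h : M.IsLastInBlock v (M.B₂ T v) w)
    (h' : M.IsLastInBlock v (M.B₂ T v) w') : w = w' := by
  rw [S.isLastInBlock_iff ho] at h h'
  exact S.pos_injective h.1.1 h'.1.1 (le_antisymm (h'.2 _ h.1) (h.2 _ h'.1))

theorem isFirstInBlock_unique {v w w' : V} (h : M.IsFirstInBlock v (M.B₄ T v) w)
    (h' : M.IsFirstInBlock v (M.B₄ T v) w') : w = w' := by
  rw [S.isFirstInBlock_iff ho] at h h'
  exact S.pos_injective h.1.1.symm h'.1.1.symm (le_antisymm (h.2 _ h'.1) (h'.2 _ h.1))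

/-- The heart of the disjointness of T₂ and Tₙ. Let `x` follow `w` around `v`; by the triangle, `x`
comes right before `v` around `w`. Extremality of `w` and `v` keeps `x` out of B₂(v) and B₄(w), and
each remaining combination of blocks contradicts the preordering or the ancestor relation. The
exception is a wrap at the root, which forces `v` to be `S.last`. -/
theorem not_isLastInBlock_of_isFirstInBlock {v w : V} (hz : v ≠ S.last)
    (hv : M.IsLastInBlock v (M.B₂ T v) w) : ¬ M.IsFirstInBlock w (M.B₄ T w) v := by
  intro hw
  rw [S.isLastInBlock_iff ho] at hv
  rw [S.isFirstInBlock_iff ho] at hw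
  obtain ⟨hvw, hmax⟩ := hv
  obtain ⟨-, hmin⟩ := hw
  obtain ⟨x, hx⟩ := M.exists_follows_right hvw.1
  have hx' := hx.rotate S.triangle
  have hx'' := hx'.rotate S.triangle
  have hwv := S.key_lt_of_mem_B₂ hvw
  have hvr := S.ne_root_of_mem_B₂ hvw
  have hwr := S.ne_root_of_mem_B₂' hvw
  have h1 : x ∉ M.B₂ T v := by
    intro h
    have h2 := hmax x h
    have h3 := S.pos_add_one_lt hvr hvw.1 (S.not_isParent_of_mem_B₂ hvw)
    rcases S.pos_of_follows hx with ⟨-, h4⟩ | ⟨h4, -⟩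
    · omega
    · omega
  have h2 : w ∉ M.B₂ T x := by
    intro h
    have h2 := hmin x h
    have h3 := S.pos_add_one_lt hwr h.1.symm (S.not_isParent_of_mem_B₂' h)
    rcases S.pos_of_follows hx' with ⟨-, h4⟩ | ⟨h4, -⟩
    · omega
    · omega
  rcases S.kind ho hx.adj_right with hv | hv | hv | hv
  · rcases S.kind ho hx'.adj_left with hw | hw | hw | hw
    · rw [S.pos_lt_iff_of_isParent hw hv] at hwv
      rcases S.pos_of_follows hx'' with ⟨-, h4⟩ | ⟨h4, -⟩
      · omega
      · by_cases hxr : x = T.root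
        · subst hxr
          refine hz (S.pos_injective hv.adj (S.isParent_last ho).adj ?_)
          have := S.pos_prev_start T.root
          unfold last
          omega
        · exact hv.asymm (S.eq_parent_of_pos hxr hv.adj h4)
    · exact lt_asymm hwv (S.child_key_lt hw hv)
    · exact hvw.2.1.1 ((Relation.ReflTransGen.single hw).tail hv)
    · exact h2 hw
  · exact h1 hv
  · have hvx := S.key_lt_of_isParent hv
    rcases S.kind ho hx'.adj_left with hw | hw | hw | hw
    · exact hvw.2.1.2 ((Relation.ReflTransGen.single hv).tail hw)
    · exact lt_asymm hwv (hvx.trans (S.key_lt_of_mem_B₂ hw))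
    · exact hvw.1.ne (hv.unique hw)
    · exact h2 hw
  · have hvx := S.key_lt_of_mem_B₂ hv
    rcases S.kind ho hx'.adj_left with hw | hw | hw | hw
    · exact lt_asymm hwv (hvx.trans (S.key_lt_of_isParent hw))
    · exact lt_asymm hwv (hvx.trans (S.key_lt_of_mem_B₂ hw))
    · exact lt_asymm hvx (S.child_key_lt hvw hw)
    · exact h2 hw

end PlaneGraph.Tour

/-! ### Counting edges by Euler's formula. -/

namespace PlaneGraph

variable {V : Type*} {M : PlaneGraph V} {T : RootedSubtree M.graph}

theorem card_dart [Finite V] : Nat.card M.graph.Dart = 2 * M.graph.edgeSet.ncard := by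
  classical
  have := Fintype.ofFinite V
  rw [Nat.card_eq_fintype_card, M.graph.dart_card_eq_twice_card_edges,
    ← SimpleGraph.coe_edgeFinset, Set.ncard_coe_finset]

theorem card_dart_eq_three_mul_card_face [Finite V]
    (h3 : ∀ d, M.facePerm (M.facePerm (M.facePerm d)) = d) :
    Nat.card M.graph.Dart = 3 * Nat.card M.Face := by
  have hne : ∀ d, M.facePerm d ≠ d := fun d h => by
    have h1 := RotationSystem.facePerm_fst d
    rw [h] at h1
    exact d.fst_ne_snd h1
  have hne' : ∀ d, M.facePerm (M.facePerm d) ≠ d := fun d h => by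
    have h1 := h3 d
    rw [h] at h1
    exact hne d h1
  have hface : ∀ d, M.face (M.facePerm d) = M.face d := fun d =>
    (RotationSystem.mem_face_iff h3).mpr (.inr (.inl rfl))
  let g : M.Face → M.graph.Dart := Quotient.out
  have hg : ∀ q, M.face (g q) = q := fun q => Quotient.out_eq q
  -- A representative of each face together with its two images under `facePerm` exhausts the darts;
  -- they are distinct because `facePerm` and its square have no fixed points.
  let F : Fin 3 × M.Face → M.graph.Dart := fun x =>
    match x.1 with
    | 0 => g x.2
    | 1 => M.facePerm (g x.2)
    | 2 => M.facePerm (M.facePerm (g x.2))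
  have hF : ∀ x, M.face (F x) = x.2 := by
    rintro ⟨i, q⟩
    fin_cases i
    · exact hg q
    · exact (hface _).trans (hg q)
    · exact (hface _).trans ((hface _).trans (hg q))
  have hbij : Function.Bijective F := by
    constructor
    · rintro ⟨i, q⟩ ⟨j, q'⟩ h
      have hq : q = q' := by
        have := congrArg M.face h
        rwa [hF, hF] at this
      subst hq
      have hi : i = j := by
        fin_cases i <;> fin_cases j <;> first
          | rfl
          | exact absurd h (hne _)
          | exact absurd h.symm (hne _)
          | exact absurd h (hne' _)
          | exact absurd h.symm (hne' _)
      rw [hi]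
    · intro d
      have := (RotationSystem.mem_face_iff h3).mp (hg (M.face d)).symm
      rcases this with h | h | h
      · exact ⟨(0, M.face d), h.symm⟩
      · exact ⟨(1, M.face d), h.symm⟩
      · exact ⟨(2, M.face d), h.symm⟩
  rw [← Nat.card_eq_of_bijective F hbij, Nat.card_prod, Nat.card_eq_fintype_card, Fintype.card_fin]

/-- Counting darts by edges and by faces gives 2e = 3f; elimination of f from Euler's formula yields
e = 3n - 6. -/
theorem card_edges [Finite V] (h3 : ∀ d, M.facePerm (M.facePerm (M.facePerm d)) = d) :
    M.graph.edgeSet.ncard + 6 = 3 * Nat.card V := by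
  have h1 := M.card_dart
  have h2 := M.card_dart_eq_three_mul_card_face h3
  have h4 := M.euler
  omega

namespace Tour

variable [Finite V] (S : M.Tour T)

set_option linter.unusedSectionVars false

include S

theorem isInternalNode_iff {v : V} :
    M.IsInternalNode v ↔ v ≠ T.root ∧ v ≠ S.first ∧ v ≠ S.last := by
  rw [IsInternalNode, S.isExternalNode_iff]
  push Not
  rfl

variable (ho : ∀ v, M.IsOrderlyNode T v)

include ho

theorem ncard_internal : {v | M.IsInternalNode v}.ncard + 3 = Nat.card V := by
  have h1 : {v | M.IsInternalNode v}ᶜ = {T.root, S.first, S.last} := by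
    ext v
    change ¬ ¬ _ ↔ _
    rw [not_not, S.isExternalNode_iff]
    rfl
  have h2 := Set.ncard_add_ncard_compl {v | M.IsInternalNode v}
  rw [h1, Set.ncard_insert_of_notMem, Set.ncard_pair S.first_ne_last] at h2
  · exact h2
  · rintro (h | h)
    · exact S.first_ne_root ho h.symm
    · exact S.last_ne_root ho h.symm

theorem ncard_internalEdges : M.internalEdges.ncard + 9 = 3 * Nat.card V := by
  have h1 : M.externalEdges ⊆ M.graph.edgeSet := by
    rintro e ⟨d, -, rfl⟩
    exact d.edge_mem
  have h2 := Set.ncard_sdiff_add_ncard_of_subset h1 (Set.toFinite _)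
  have h3 : M.externalEdges.ncard = 3 := by
    have hf := S.first_ne_root ho
    have hl := S.last_ne_root ho
    have hfl := S.first_ne_last
    rw [S.externalEdges_eq, Set.ncard_eq_three]
    refine ⟨_, _, _, ?_, ?_, ?_, rfl⟩ <;> rw [Ne, Sym2.eq_iff] <;> grind
  have h4 := M.card_edges S.triangle
  change M.internalEdges.ncard + _ = _ at h2
  omega

omit ho in
theorem mem_internalEdges {v w : V} (hv : M.IsInternalNode v) (h : M.graph.Adj v w) :
    s(v, w) ∈ M.internalEdges := by
  refine ⟨h, ?_⟩
  obtain ⟨h1, h2, h3⟩ := S.isInternalNode_iff.mp hv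
  rw [S.externalEdges_eq]
  simp only [Set.mem_insert_iff, Set.mem_singleton_iff, Sym2.eq_iff]
  grind

theorem mem_B₂_of_isLastInBlock {v w : V} (h : M.IsLastInBlock v (M.B₂ T v) w) :
    w ∈ M.B₂ T v := ((S.isLastInBlock_iff ho).mp h).1

theorem mem_B₂_of_isFirstInBlock {v w : V} (h : M.IsFirstInBlock v (M.B₄ T v) w) :
    v ∈ M.B₂ T w := ((S.isFirstInBlock_iff ho).mp h).1

/-! ### The three trees and the realizer. -/

theorem exists_tree₁ : ∃ T₁ : RootedSubtree M.graph, T₁.root = T.root ∧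
    (∀ u v, T₁.IsParent u v ↔ M.IsInternalNode v ∧ T.IsParent u v) ∧
    T₁.tree.edgeSet.ncard = {v | M.IsInternalNode v}.ncard := by
  have hp : ∀ v, M.IsInternalNode v → T.IsParent (S.parent v) v := fun v hv =>
    S.isParent_parent (S.isInternalNode_iff.mp hv).1
  obtain ⟨T₁, h1, h2, -, h4⟩ := RootedSubtree.exists_of_parent M.graph T.root
    {v | M.IsInternalNode v} S.parent T.depth
    (fun h => (S.isInternalNode_iff.mp h).1 rfl)
    (fun v hv => (hp v hv).adj.symm)
    (fun v hv => by
      by_cases hr : S.parent v = T.root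
      · exact .inr hr
      -- The parent is internal or the root, since the other two external nodes are leaves of `T`.
      · refine .inl (S.isInternalNode_iff.mpr ⟨hr, fun h => ?_, fun h => ?_⟩)
        · exact S.not_isParent_first ho v (h ▸ hp v hv)
        · exact S.not_isParent_last ho v (h ▸ hp v hv))
    (fun v hv => by rw [(hp v hv).2]; exact Nat.lt_succ_self _)
  refine ⟨T₁, h1, fun u v => (h2 u v).trans ?_, h4⟩
  constructor
  · rintro ⟨hv, rfl⟩
    exact ⟨hv, hp v hv⟩
  · rintro ⟨hv, h⟩
    exact ⟨hv, h.unique (hp v hv)⟩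

theorem exists_tree₂ : ∃ T₂ : RootedSubtree M.graph, T₂.root = S.first ∧
    (∀ u v, T₂.IsParent u v ↔ M.IsInternalNode v ∧ M.IsLastInBlock v (M.B₂ T v) u) ∧
    T₂.tree.edgeSet.ncard = {v | M.IsInternalNode v}.ncard := by
  have : ∀ v, ∃ w, M.IsInternalNode v → M.IsLastInBlock v (M.B₂ T v) w := by
    intro v
    by_cases hv : M.IsInternalNode v
    · obtain ⟨h1, h2, -⟩ := S.isInternalNode_iff.mp hv
      obtain ⟨w, hw⟩ := S.exists_isLastInBlock ho h1 h2
      exact ⟨w, fun _ => hw⟩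
    · exact ⟨v, fun h => absurd h hv⟩
  choose p hp using this
  have hB := fun v hv => S.mem_B₂_of_isLastInBlock ho (hp v hv)
  obtain ⟨T₂, h1, h2, -, h4⟩ := RootedSubtree.exists_of_parent M.graph S.first
    -- The rank is the preorder index, which decreases from a node to its T₂-parent. For Tₙ the
    -- number of later nodes plays this role.
    {v | M.IsInternalNode v} p (fun v => {y | S.key y < S.key v}.ncard)
    (fun h => (S.isInternalNode_iff.mp h).2.1 rfl)
    (fun v hv => (hB v hv).1)
    (fun v hv => by
      by_cases hr : p v = S.first
      · exact .inr hr
      · refine .inl (S.isInternalNode_iff.mpr ⟨S.ne_root_of_mem_B₂' (hB v hv), hr, fun h => ?_⟩)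
        have h1 := S.key_lt_of_mem_B₂ (hB v hv)
        rw [h] at h1
        exact lt_asymm h1 (S.key_lt_last ho (S.isInternalNode_iff.mp hv).2.2))
    (fun v hv => by
      have h1 := S.key_lt_of_mem_B₂ (hB v hv)
      exact Set.ncard_lt_ncard ⟨fun y hy => lt_trans hy h1, fun h =>
        lt_irrefl (S.key (p v)) (h h1)⟩)
  refine ⟨T₂, h1, fun u v => (h2 u v).trans ?_, h4⟩
  constructor
  · rintro ⟨hv, rfl⟩
    exact ⟨hv, hp v hv⟩
  · rintro ⟨hv, h⟩
    exact ⟨hv, S.isLastInBlock_unique ho h (hp v hv)⟩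

theorem exists_treeₙ : ∃ Tₙ : RootedSubtree M.graph, Tₙ.root = S.last ∧
    (∀ u v, Tₙ.IsParent u v ↔ M.IsInternalNode v ∧ M.IsFirstInBlock v (M.B₄ T v) u) ∧
    Tₙ.tree.edgeSet.ncard = {v | M.IsInternalNode v}.ncard := by
  have : ∀ v, ∃ w, M.IsInternalNode v → M.IsFirstInBlock v (M.B₄ T v) w := by
    intro v
    by_cases hv : M.IsInternalNode v
    · obtain ⟨h1, -, h2⟩ := S.isInternalNode_iff.mp hv
      obtain ⟨w, hw⟩ := S.exists_isFirstInBlock ho h1 h2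
      exact ⟨w, fun _ => hw⟩
    · exact ⟨v, fun h => absurd h hv⟩
  choose p hp using this
  have hB := fun v hv => S.mem_B₂_of_isFirstInBlock ho (hp v hv)
  obtain ⟨Tₙ, h1, h2, -, h4⟩ := RootedSubtree.exists_of_parent M.graph S.last
    {v | M.IsInternalNode v} p (fun v => {y | S.key v < S.key y}.ncard)
    (fun h => (S.isInternalNode_iff.mp h).2.2 rfl)
    (fun v hv => (hB v hv).1.symm)
    (fun v hv => by
      by_cases hr : p v = S.last
      · exact .inr hr
      · refine .inl (S.isInternalNode_iff.mpr ⟨S.ne_root_of_mem_B₂ (hB v hv), fun h => ?_, hr⟩)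
        have h1 := S.key_lt_of_mem_B₂ (hB v hv)
        rw [h] at h1
        obtain ⟨h2, h3, -⟩ := S.isInternalNode_iff.mp hv
        exact lt_asymm h1 (S.key_first_lt ho h2 h3))
    (fun v hv => by
      have h1 := S.key_lt_of_mem_B₂ (hB v hv)
      exact Set.ncard_lt_ncard ⟨fun y hy => lt_trans h1 hy, fun h =>
        lt_irrefl (S.key (p v)) (h h1)⟩)
  refine ⟨Tₙ, h1, fun u v => (h2 u v).trans ?_, h4⟩
  constructor
  · rintro ⟨hv, rfl⟩
    exact ⟨hv, hp v hv⟩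
  · rintro ⟨hv, h⟩
    exact ⟨hv, S.isFirstInBlock_unique ho h (hp v hv)⟩

variable {T₁ T₂ Tₙ : RootedSubtree M.graph}
  (h₁ : ∀ u v, T₁.IsParent u v ↔ M.IsInternalNode v ∧ T.IsParent u v)
  (h₂ : ∀ u v, T₂.IsParent u v ↔ M.IsInternalNode v ∧ M.IsLastInBlock v (M.B₂ T v) u)
  (hₙ : ∀ u v, Tₙ.IsParent u v ↔ M.IsInternalNode v ∧ M.IsFirstInBlock v (M.B₄ T v) u)

include h₁ h₂ in
theorem disjoint₁₂ : Disjoint T₁.tree.edgeSet T₂.tree.edgeSet := by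
  rw [Set.disjoint_left]
  intro e
  induction e using Sym2.ind with
  | _ u v =>
    simp only [RootedSubtree.mem_edgeSet_iff, h₁, h₂]
    rintro (⟨-, h⟩ | ⟨-, h⟩) (⟨-, h'⟩ | ⟨-, h'⟩)
    · exact S.not_isParent_of_mem_B₂ (S.mem_B₂_of_isLastInBlock ho h') h
    · exact S.not_isParent_of_mem_B₂' (S.mem_B₂_of_isLastInBlock ho h') h
    · exact S.not_isParent_of_mem_B₂' (S.mem_B₂_of_isLastInBlock ho h') h
    · exact S.not_isParent_of_mem_B₂ (S.mem_B₂_of_isLastInBlock ho h') h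

include h₁ hₙ in
theorem disjoint₁ₙ : Disjoint T₁.tree.edgeSet Tₙ.tree.edgeSet := by
  rw [Set.disjoint_left]
  intro e
  induction e using Sym2.ind with
  | _ u v =>
    simp only [RootedSubtree.mem_edgeSet_iff, h₁, hₙ]
    rintro (⟨-, h⟩ | ⟨-, h⟩) (⟨-, h'⟩ | ⟨-, h'⟩)
    · exact S.not_isParent_of_mem_B₂' (S.mem_B₂_of_isFirstInBlock ho h') h
    · exact S.not_isParent_of_mem_B₂ (S.mem_B₂_of_isFirstInBlock ho h') h
    · exact S.not_isParent_of_mem_B₂ (S.mem_B₂_of_isFirstInBlock ho h') h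
    · exact S.not_isParent_of_mem_B₂' (S.mem_B₂_of_isFirstInBlock ho h') h

include h₂ hₙ in
-- An edge used with the same child in both trees would have its parent both before and after the
-- child in the preordering. An edge used with opposite children is excluded by
-- `not_isLastInBlock_of_isFirstInBlock`.
theorem disjoint₂ₙ : Disjoint T₂.tree.edgeSet Tₙ.tree.edgeSet := by
  have key : ∀ u v, T₂.IsParent u v → Tₙ.IsParent u v ∨ Tₙ.IsParent v u → False := by
    intro u v h h'
    obtain ⟨hv, h⟩ := (h₂ u v).mp h
    rw [hₙ, hₙ] at h'
    rcases h' with ⟨-, h'⟩ | ⟨-, h'⟩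
    · exact lt_asymm (S.key_lt_of_mem_B₂ (S.mem_B₂_of_isLastInBlock ho h))
        (S.key_lt_of_mem_B₂ (S.mem_B₂_of_isFirstInBlock ho h'))
    · exact S.not_isLastInBlock_of_isFirstInBlock ho (S.isInternalNode_iff.mp hv).2.2 h h'
  rw [Set.disjoint_left]
  intro e
  induction e using Sym2.ind with
  | _ u v =>
    simp only [RootedSubtree.mem_edgeSet_iff]
    rintro (h | h) h'
    · exact key u v h h'
    · exact key v u h h'.symm

omit ho S in
theorem edgeSet_eq_of_isParent_iff {T' : RootedSubtree M.graph} {P : V → V → Prop}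
    (h : ∀ u v, T'.IsParent u v ↔ M.IsInternalNode v ∧ P v u) :
    T'.tree.edgeSet = {e | ∃ v w, M.IsInternalNode v ∧ P v w ∧ e = s(v, w)} := by
  ext e
  induction e using Sym2.ind with
  | _ u v =>
    rw [RootedSubtree.mem_edgeSet_iff, h, h]
    constructor
    · rintro (⟨h1, h2⟩ | ⟨h1, h2⟩)
      · exact ⟨v, u, h1, h2, Sym2.eq_swap⟩
      · exact ⟨u, v, h1, h2, rfl⟩
    · rintro ⟨a, b, h1, h2, h3⟩
      rcases Sym2.eq_iff.mp h3 with ⟨rfl, rfl⟩ | ⟨rfl, rfl⟩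
      · exact .inr ⟨h1, h2⟩
      · exact .inl ⟨h1, h2⟩

omit ho in
theorem edgeSet_subset_internalEdges {T' : RootedSubtree M.graph}
    (h : ∀ u v, T'.IsParent u v → M.IsInternalNode v) : T'.tree.edgeSet ⊆ M.internalEdges := by
  intro e
  induction e using Sym2.ind with
  | _ u v =>
    rw [RootedSubtree.mem_edgeSet_iff]
    rintro (h' | h')
    · rw [Sym2.eq_swap]
      exact S.mem_internalEdges (h _ _ h') h'.adj.symm
    · exact S.mem_internalEdges (h _ _ h') h'.adj.symm

include h₁ h₂ hₙ

/-- Three disjoint sets of n - 3 edges each lie inside a set of 3n - 9 edges, so they fill it. -/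
theorem union_edgeSet
    (hc₁ : T₁.tree.edgeSet.ncard = {v | M.IsInternalNode v}.ncard)
    (hc₂ : T₂.tree.edgeSet.ncard = {v | M.IsInternalNode v}.ncard)
    (hcₙ : Tₙ.tree.edgeSet.ncard = {v | M.IsInternalNode v}.ncard) :
    T₁.tree.edgeSet ∪ T₂.tree.edgeSet ∪ Tₙ.tree.edgeSet = M.internalEdges := by
  refine Set.eq_of_subset_of_ncard_le (Set.union_subset (Set.union_subset ?_ ?_) ?_) ?_
  · exact S.edgeSet_subset_internalEdges fun u v h => ((h₁ u v).mp h).1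
  · exact S.edgeSet_subset_internalEdges fun u v h => ((h₂ u v).mp h).1
  · exact S.edgeSet_subset_internalEdges fun u v h => ((hₙ u v).mp h).1
  · rw [Set.ncard_union_eq, Set.ncard_union_eq (S.disjoint₁₂ ho h₁ h₂), hc₁, hc₂, hcₙ]
    · have := S.ncard_internal ho
      have := S.ncard_internalEdges ho
      omega
    · exact (S.disjoint₁ₙ ho h₁ hₙ).union_left (S.disjoint₂ₙ ho h₂ hₙ)

/-- With `a` the last node of B₂(v) and `b` the first of B₄(v), the positions before `a` must be
children in Tₙ, those between `a` and `b` children in T₁, and those after `b` children in T₂. -/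
theorem neighborsFormBlocks_realizer
    (hu : T₁.tree.edgeSet ∪ T₂.tree.edgeSet ∪ Tₙ.tree.edgeSet = M.internalEdges)
    {v : V} (hv : M.IsInternalNode v) :
    M.NeighborsFormBlocks v
      ![{u | T₁.IsParent u v}, {u | Tₙ.IsParent v u}, {u | T₂.IsParent u v},
        {u | T₁.IsParent v u}, {u | Tₙ.IsParent u v}, {u | T₂.IsParent v u}] := by
  obtain ⟨hvr, hvf, hvl⟩ := S.isInternalNode_iff.mp hv
  have hpar := S.prev_parent v hvr
  obtain ⟨a, ha⟩ := S.exists_isLastInBlock ho hvr hvf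
  obtain ⟨b, hb⟩ := S.exists_isFirstInBlock ho hvr hvl
  obtain ⟨ha1, ha2⟩ := (S.isLastInBlock_iff ho).mp ha
  obtain ⟨hb1, hb2⟩ := (S.isFirstInBlock_iff ho).mp hb
  have hab : S.pos v a < S.pos v b := by
    by_contra! h
    have := S.mem_B₂_of_pos_le ho hb1.1.symm (S.not_isParent_of_mem_B₂' hb1) ha1 h
    exact lt_asymm (S.key_lt_of_mem_B₂ this) (S.key_lt_of_mem_B₂ hb1)
  -- Darts are counted from the one to the parent in `T`, which has index 0; hence a neighbor `w`
  -- other than that parent has index `S.pos v w + 1`.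
  let label : ℕ → Fin 6 := fun k =>
    if k = 0 then 0 else if k < S.pos v a + 1 then 1 else if k = S.pos v a + 1 then 2
    else if k < S.pos v b + 1 then 3 else if k = S.pos v b + 1 then 4 else 5
  let B : Fin 6 → Set V := ![{u | T₁.IsParent u v}, {u | Tₙ.IsParent v u}, {u | T₂.IsParent u v},
        {u | T₁.IsParent v u}, {u | Tₙ.IsParent u v}, {u | T₂.IsParent v u}]
  have hmono : Monotone label := by
    intro i j hij
    simp only [label]
    split_ifs <;> omega
  have hpos : ∀ k < M.degree v, ∀ w,
      ((M.next ^ k) (M.next⁻¹ (S.start v))).snd = w →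
      (k = 0 ∧ T.IsParent w v) ∨ (k = S.pos v w + 1 ∧ ¬ T.IsParent w v) := by
    rintro k hk w rfl
    cases k with
    | zero => exact .inl ⟨rfl, hpar⟩
    | succ k =>
      right
      have h1 : (M.next ^ (k + 1)) (M.next⁻¹ (S.start v)) = (M.next ^ k) (S.start v) := by
        rw [pow_succ, Equiv.Perm.mul_apply, ← Equiv.Perm.mul_apply M.next, mul_inv_cancel,
          Equiv.Perm.one_apply]
      rw [h1]
      have h2 := S.pos_eq_of_snd (v := v) (k := k) (by omega) rfl
      refine ⟨by rw [h2], fun h => ?_⟩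
      have := S.pos_parent h
      omega
  have hadj : ∀ k, M.graph.Adj v ((M.next ^ k) (M.next⁻¹ (S.start v))).snd := by
    intro k
    have := ((M.next ^ k) (M.next⁻¹ (S.start v))).adj
    rwa [M.next_pow_fst, RotationSystem.prev_fst, S.start_fst] at this
  have hex : ∀ w, M.graph.Adj v w → ∃ c, w ∈ B c := by
    intro w hw
    have h1 := S.mem_internalEdges hv hw
    rw [← hu] at h1
    rcases h1 with (h1 | h1) | h1 <;> rw [RootedSubtree.mem_edgeSet_iff] at h1 <;>
      rcases h1 with h1 | h1
    · exact ⟨3, h1⟩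
    · exact ⟨0, h1⟩
    · exact ⟨5, h1⟩
    · exact ⟨2, h1⟩
    · exact ⟨1, h1⟩
    · exact ⟨4, h1⟩
  have hlabel : ∀ k < M.degree v, ∀ c,
      ((M.next ^ k) (M.next⁻¹ (S.start v))).snd ∈ B c → label k = c := by
    intro k hk c hc
    have hk' := hpos k hk _ rfl
    have hw := hadj k
    generalize ((M.next ^ k) (M.next⁻¹ (S.start v))).snd = w at hc hk' hw
    obtain rfl | rfl | rfl | rfl | rfl | rfl :
        c = 0 ∨ c = 1 ∨ c = 2 ∨ c = 3 ∨ c = 4 ∨ c = 5 := by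
      clear hc
      revert c
      decide
    · have h1 := ((h₁ w v).mp hc).2
      rcases hk' with ⟨rfl, -⟩ | ⟨-, h2⟩
      · simp [label]
      · exact absurd h1 h2
    · have h1 := ((hₙ v w).mp hc).2
      have h2 := S.mem_B₂_of_isFirstInBlock ho h1
      rcases hk' with ⟨-, h3⟩ | ⟨rfl, -⟩
      · exact absurd h3 (S.not_isParent_of_mem_B₂ h2)
      · have h3 := ha2 w h2
        have h4 : S.pos v w ≠ S.pos v a := fun h => by
          -- A Tₙ-child of `v` lies in B₂(v); it cannot be `a` itself, since the edge to `a` belongs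
          -- to T₂.
          rw [S.pos_injective hw ha1.1 h] at h1
          exact S.not_isLastInBlock_of_isFirstInBlock ho hvl ha h1
        have h5 : S.pos v w < S.pos v a := by omega
        simp [label, h5]
    · have h1 := ((h₂ w v).mp hc).2
      obtain rfl := S.isLastInBlock_unique ho h1 ha
      rcases hk' with ⟨-, h3⟩ | ⟨rfl, -⟩
      · exact absurd h3 (S.not_isParent_of_mem_B₂ ha1)
      · simp [label]
    · have h1 := ((h₁ v w).mp hc).2
      rcases hk' with ⟨-, h3⟩ | ⟨rfl, h2⟩
      · exact absurd h3 h1.asymm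
      · have h3 : S.pos v a < S.pos v w := by
          by_contra! h
          exact S.not_isParent_of_mem_B₂' (S.mem_B₂_of_pos_le ho hw h2 ha1 h) h1
        have h4 : S.pos v w < S.pos v b := by
          by_contra! h
          exact S.not_isParent_of_mem_B₂ (S.mem_B₄_of_pos_le ho hb1 hw h2 h) h1
        have h5 : ¬ S.pos v w < S.pos v a := by omega
        have h6 : S.pos v w ≠ S.pos v a := by omega
        simp [label, h4, h5, h6]
    · have h1 := ((hₙ w v).mp hc).2
      obtain rfl := S.isFirstInBlock_unique ho h1 hb
      rcases hk' with ⟨-, h3⟩ | ⟨rfl, -⟩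
      · exact absurd h3 (S.not_isParent_of_mem_B₂' hb1)
      · have h5 : ¬ S.pos v w < S.pos v a := by omega
        have h6 : S.pos v w ≠ S.pos v a := by omega
        simp [label, h5, h6]
    · obtain ⟨hwi, h1⟩ := (h₂ v w).mp hc
      have h2 := S.mem_B₂_of_isLastInBlock ho h1
      rcases hk' with ⟨-, h3⟩ | ⟨rfl, -⟩
      · exact absurd h3 (S.not_isParent_of_mem_B₂' h2)
      · have h3 := hb2 w h2
        have h4 : S.pos v w ≠ S.pos v b := fun h => by
          obtain rfl := S.pos_injective hw hb1.1.symm h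
          exact S.not_isLastInBlock_of_isFirstInBlock ho (S.isInternalNode_iff.mp hwi).2.2 h1 hb
        have h5 : ¬ S.pos v w < S.pos v a := by omega
        have h6 : S.pos v w ≠ S.pos v a := by omega
        have h7 : ¬ S.pos v w < S.pos v b := by omega
        simp [label, h4, h5, h6, h7]
  refine ⟨M.next⁻¹ (S.start v), label, (RotationSystem.prev_fst _).trans (S.start_fst v), hmono,
    fun k hk c => ⟨hlabel k hk c, fun h => ?_⟩⟩
  -- Since the three trees cover all edges at `v`, the neighbor lies in some block, and `hlabel`
  -- identifies its index with the label. This gives the converse of `hlabel`.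
  obtain ⟨c', hc'⟩ := hex _ (hadj k)
  rwa [← h, hlabel k hk c' hc']

theorem isRealizer (hr₁ : T₁.root = T.root) (hr₂ : T₂.root = S.first) (hrₙ : Tₙ.root = S.last)
    (hc₁ : T₁.tree.edgeSet.ncard = {v | M.IsInternalNode v}.ncard)
    (hc₂ : T₂.tree.edgeSet.ncard = {v | M.IsInternalNode v}.ncard)
    (hcₙ : Tₙ.tree.edgeSet.ncard = {v | M.IsInternalNode v}.ncard) :
    M.IsRealizer T₁ T₂ Tₙ where
  external₁ := S.isExternalNode_iff.mpr (.inl hr₁)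
  external₂ := S.isExternalNode_iff.mpr (.inr (.inl hr₂))
  externalₙ := S.isExternalNode_iff.mpr (.inr (.inr hrₙ))
  root_ne₁₂ := by rw [hr₁, hr₂]; exact (S.first_ne_root ho).symm
  root_ne₁ₙ := by rw [hr₁, hrₙ]; exact (S.last_ne_root ho).symm
  root_ne₂ₙ := by rw [hr₂, hrₙ]; exact S.first_ne_last
  disjoint₁₂ := S.disjoint₁₂ ho h₁ h₂
  disjoint₁ₙ := S.disjoint₁ₙ ho h₁ hₙ
  disjoint₂ₙ := S.disjoint₂ₙ ho h₂ hₙ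
  union := S.union_edgeSet ho h₁ h₂ hₙ hc₁ hc₂ hcₙ
  parent := by
    intro v hv
    obtain ⟨hvr, hvf, hvl⟩ := S.isInternalNode_iff.mp hv
    obtain ⟨a, ha⟩ := S.exists_isLastInBlock ho hvr hvf
    obtain ⟨b, hb⟩ := S.exists_isFirstInBlock ho hvr hvl
    exact ⟨⟨_, (h₁ _ v).mpr ⟨hv, S.isParent_parent hvr⟩⟩, ⟨a, (h₂ a v).mpr ⟨hv, ha⟩⟩,
      ⟨b, (hₙ b v).mpr ⟨hv, hb⟩⟩⟩
  blocks := fun _ hv => S.neighborsFormBlocks_realizer ho h₁ h₂ hₙ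
    (S.union_edgeSet ho h₁ h₂ hₙ hc₁ hc₂ hcₙ) hv

omit h₂ hₙ in
theorem edgeSet_tree₁ :
    T₁.tree.edgeSet = T.tree.edgeSet \ {s(T.root, S.first), s(T.root, S.last)} := by
  have hf := S.isParent_first ho
  have hl := S.isParent_last ho
  have key : ∀ u v, T.IsParent u v →
      (M.IsInternalNode v ↔
        s(u, v) ∉ ({s(T.root, S.first), s(T.root, S.last)} : Set (Sym2 V))) := by
    intro u v h
    have hv : v ≠ T.root := by
      rintro rfl
      exact T.not_isParent_root _ h
    rw [S.isInternalNode_iff]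
    simp only [Set.mem_insert_iff, Set.mem_singleton_iff, Sym2.eq_iff, not_or, not_and]
    constructor
    · rintro ⟨-, h1, h2⟩
      exact ⟨⟨fun _ => h1, fun _ => hv⟩, fun _ => h2, fun _ => hv⟩
    · rintro ⟨⟨h1, -⟩, h2, -⟩
      refine ⟨hv, ?_, ?_⟩
      · rintro rfl
        exact h1 (h.unique hf) rfl
      · rintro rfl
        exact h2 (h.unique hl) rfl
  ext e
  induction e using Sym2.ind with
  | _ u v =>
    rw [Set.mem_sdiff, RootedSubtree.mem_edgeSet_iff, RootedSubtree.mem_edgeSet_iff, h₁, h₁]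
    constructor
    · rintro (⟨h, h'⟩ | ⟨h, h'⟩)
      · exact ⟨.inl h', (key u v h').mp h⟩
      · refine ⟨.inr h', ?_⟩
        rw [Sym2.eq_swap (a := u)]
        exact (key v u h').mp h
    · rintro ⟨h | h, h'⟩
      · exact .inl ⟨(key u v h).mpr h', h⟩
      · rw [Sym2.eq_swap (a := u)] at h'
        exact .inr ⟨(key v u h).mpr h', h⟩

end Tour

end PlaneGraph

/-! ### The walk around the tree and the local tests. -/

theorem List.lt_or_prefix_of_lt_concat {l q : List ℕ} {j : ℕ} (h : l < q ++ [j]) :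
    l < q ∨ q <+: l := by
  induction j with
  | zero =>
    rw [lt_concat_zero_iff] at h
    rcases lt_or_eq_of_le h with h | rfl
    · exact .inl h
    · exact .inr prefix_rfl
  | succ j ih =>
    rcases lt_concat_succ_iff.mp h with h | h
    · exact ih h
    · exact .inr ((prefix_append _ _).trans h)

namespace PlaneGraph

variable {V : Type*} {M : PlaneGraph V} {T : RootedSubtree M.graph}

open Classical in
/-- One step of the depth-first traversal of `T`. -/
noncomputable def tourStep (M : PlaneGraph V) (T : RootedSubtree M.graph) :
    Equiv.Perm M.graph.Dart :=
  M.next * Function.Involutive.toPerm (fun d => if T.tree.Adj d.fst d.snd then d.symm else d)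
    (fun d => by
      by_cases h : T.tree.Adj d.fst d.snd
      · have h' : T.tree.Adj d.symm.fst d.symm.snd := h.symm
        simp only [if_pos h, if_pos h', SimpleGraph.Dart.symm_symm]
      · simp only [if_neg h])

theorem tourStep_of_adj {d : M.graph.Dart} (h : T.tree.Adj d.fst d.snd) :
    M.tourStep T d = M.next d.symm :=
  congrArg M.next (if_pos h)

theorem tourStep_of_not_adj {d : M.graph.Dart} (h : ¬ T.tree.Adj d.fst d.snd) :
    M.tourStep T d = M.next d :=
  congrArg M.next (if_neg h)

namespace Tour

variable [Finite V] (S : M.Tour T)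

set_option linter.unusedSectionVars false

include S

/-- Induction on the number of nodes after `v` in the preordering, which is smaller for its
children. A dart to a child leads into the child's subtree; by induction the walk comes back over
the reversed dart and goes on with the next dart at `v`. A dart outside the tree is passed directly.
-/
theorem tourStep_sameCycle_of_fst_eq (v : V) : ∀ d e : M.graph.Dart, d.fst = v → e.fst = v →
    (M.tourStep T).SameCycle d e := by
  induction hk : {y | S.key v < S.key y}.ncard using Nat.strong_induction_on generalizing v with
  | _ k ih =>
    have hstep : ∀ d : M.graph.Dart, d.fst = v → ¬ T.IsParent d.snd v →
        (M.tourStep T).SameCycle d (M.next d) := by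
      rintro d rfl hp
      by_cases h : T.tree.Adj d.fst d.snd
      · have hc : T.IsParent d.fst d.snd := (T.isParent_or_of_adj h).resolve_right hp
        have hlt := S.key_lt_of_isParent hc
        have h1 := ih _ (by
          rw [← hk]
          exact Set.ncard_lt_ncard ⟨fun y hy => hlt.trans hy, fun h =>
            lt_irrefl (S.key d.snd) (h hlt)⟩)
          d.snd rfl (M.next d.symm) d.symm (M.next_fst _) rfl
        have h2 : M.tourStep T d.symm = M.next d := by
          rw [tourStep_of_adj h.symm, SimpleGraph.Dart.symm_symm]
        rw [← tourStep_of_adj h] at h1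
        rw [← h2, Equiv.Perm.sameCycle_apply_right]
        exact (Equiv.Perm.sameCycle_apply_left.mp h1)
      · rw [← tourStep_of_not_adj h]
        exact Equiv.Perm.sameCycle_apply_right.mpr .rfl
    have hall : ∀ j < M.degree v,
        (M.tourStep T).SameCycle (S.start v) ((M.next ^ j) (S.start v)) := by
      intro j
      induction j with
      | zero => exact fun _ => .rfl
      | succ j ihj =>
        intro hj
        refine (ihj (by omega)).trans ?_
        rw [pow_succ', Equiv.Perm.mul_apply]
        refine hstep _ ((M.next_pow_fst _ _).trans (S.start_fst v)) fun h => ?_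
        have h1 := S.pos_parent h
        rw [S.pos_eq_of_snd (k := j) (by omega) rfl] at h1
        omega
    have hall' : ∀ d : M.graph.Dart, d.fst = v → (M.tourStep T).SameCycle (S.start v) d := by
      intro d hd
      obtain ⟨j, hj, rfl⟩ := M.exists_next_pow_eq ((S.start_fst v).trans hd.symm)
      rw [S.start_fst] at hj
      exact hall j hj
    exact fun d e hd he => (hall' d hd).symm.trans (hall' e he)

theorem tourStep_sameCycle (d : M.graph.Dart) :
    (M.tourStep T).SameCycle (S.start T.root) d := by
  induction hk : T.depth d.fst generalizing d with
  | zero =>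
    rcases S.eq_root_or_isParent d.fst with h | ⟨u, hu⟩
    · exact S.tourStep_sameCycle_of_fst_eq _ _ _ (S.start_fst _) h
    · have := hu.2
      omega
  | succ k ih =>
    rcases S.eq_root_or_isParent d.fst with h | ⟨u, hu⟩
    · exact S.tourStep_sameCycle_of_fst_eq _ _ _ (S.start_fst _) h
    · have h1 := ih ⟨(u, d.fst), hu.adj⟩ (by have := hu.2; change T.depth u = k; omega)
      refine (Equiv.Perm.sameCycle_apply_right.mpr h1).trans ?_
      rw [tourStep_of_adj hu.1]
      exact S.tourStep_sameCycle_of_fst_eq _ _ _ (M.next_fst _) rfl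

theorem tourStep_isCycleOn [Fintype M.graph.Dart] :
    (M.tourStep T).IsCycleOn (Finset.univ : Finset M.graph.Dart) := by
  refine ⟨by simp, fun d _ e _ => ?_⟩
  exact (S.tourStep_sameCycle d).symm.trans (S.tourStep_sameCycle e)

theorem exists_tourStep_pow_eq (d : M.graph.Dart) :
    ∃ k < Nat.card M.graph.Dart, (M.tourStep T ^ k) (S.start T.root) = d := by
  have := Fintype.ofFinite M.graph.Dart
  rw [Nat.card_eq_fintype_card]
  exact S.tourStep_isCycleOn.exists_pow_eq (Finset.mem_univ _) (Finset.mem_univ _)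

theorem tourStep_pow_eq_iff {k : ℕ} :
    (M.tourStep T ^ k) (S.start T.root) = S.start T.root ↔ Nat.card M.graph.Dart ∣ k := by
  have := Fintype.ofFinite M.graph.Dart
  rw [Nat.card_eq_fintype_card]
  exact S.tourStep_isCycleOn.pow_apply_eq (Finset.mem_univ _)

/-- The node `x` has been reached when the traversal is about to process the dart `d`. -/
def Reached (d : M.graph.Dart) (x : V) : Prop := S.key x < S.key d.fst ++ [S.pos d.fst d.snd]

theorem reached_start {x : V} : S.Reached (S.start T.root) x ↔ x = T.root := by
  rw [Reached, S.start_fst, S.pos_start, List.lt_concat_zero_iff, S.key_root]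
  constructor
  · intro h
    by_contra hx
    exact absurd (lt_of_le_of_ne h fun e => hx (S.key_eq_nil.mp e)) (by simp)
  · rintro rfl
    rw [S.key_root]

theorem follows_next (d : M.graph.Dart) : M.Follows d.fst d.snd (M.next d).snd := ⟨d, rfl, rfl, rfl⟩

theorem follows_prev (d : M.graph.Dart) : M.Follows d.fst (M.next⁻¹ d).snd d.snd :=
  ⟨M.next⁻¹ d, RotationSystem.prev_fst d, rfl, by rw [← Equiv.Perm.mul_apply]; simp⟩

/-- The only neighbors that are reached between two consecutive darts are children. -/
theorem reached_tourStep {d : M.graph.Dart} (hd : M.tourStep T d ≠ S.start T.root) {x : V} :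
    S.Reached (M.tourStep T d) x ↔ S.Reached d x ∨ (T.IsParent d.fst d.snd ∧ x = d.snd) := by
  have hext : ∀ e : M.graph.Dart, e.fst = T.root → e.snd = (S.start T.root).snd →
      e = S.start T.root := fun e h h' =>
    RotationSystem.dart_ext (h.trans (S.start_fst _).symm) h'
  by_cases hadj : T.tree.Adj d.fst d.snd
  · have hF : M.Follows d.snd d.fst (M.tourStep T d).snd := by
      rw [tourStep_of_adj hadj]
      exact S.follows_next d.symm
    have hfst : (M.tourStep T d).fst = d.snd := by
      rw [tourStep_of_adj hadj]
      exact M.next_fst _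
    rw [Reached, Reached, hfst]
    rcases T.isParent_or_of_adj hadj with hc | hp
    · have h0 : S.pos d.snd (M.tourStep T d).snd = 0 := by
        have h1 := S.pos_parent hc
        rcases S.pos_of_follows hF with h2 | h2
        · omega
        · rw [h2.2, S.pos_start]
      rw [h0, List.lt_concat_zero_iff, ← S.key_eq hc, le_iff_lt_or_eq]
      simp only [hc, true_and]
      exact or_congr_right S.key_injective.eq_iff
    · have h0 : S.pos d.snd (M.tourStep T d).snd = S.pos d.snd d.fst + 1 := by
        rcases S.pos_of_follows hF with h2 | ⟨h2, h3⟩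
        · exact h2.2
        · by_cases hr : d.snd = T.root
          · rw [hr] at hfst h3
            exact absurd (hext _ hfst h3) hd
          · exact absurd (S.eq_parent_of_pos hr hp.adj h2) hp.asymm
      rw [h0, List.lt_concat_succ_iff, ← S.key_eq hp]
      simp only [hp.asymm, false_and, or_false]
      constructor
      · rintro (h | h)
        · exact h.trans (List.lt_iff_exists_prefix.mpr (.inl ⟨List.prefix_append _ _, by simp⟩))
        -- On the way up from `d.fst`, its whole subtree counts as reached. It was reached before,
        -- because the parent has the last position and all children have smaller ones.
        · rcases Relation.ReflTransGen.cases_head (S.isAncestor_iff_prefix.mpr h)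
            with h1 | ⟨a, h1, h2⟩
          · rw [h1]
            exact List.lt_iff_exists_prefix.mpr (.inl ⟨List.prefix_append _ _, by simp⟩)
          · obtain ⟨r, hr⟩ := S.isAncestor_iff_prefix.mp h2
            rw [← hr, S.key_eq h1, List.append_assoc, List.append_lt_append_left_iff]
            have h3 := S.pos_parent hp
            have h4 := S.pos_lt h1.adj
            have h5 : S.pos d.fst a ≠ S.pos d.fst d.snd := fun h5 => by
              obtain rfl := S.pos_injective h1.adj d.adj h5
              exact h1.asymm hp
            exact List.cons_lt_cons_iff.mpr (.inl (by omega))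
      · exact List.lt_or_prefix_of_lt_concat
  · have hF : M.Follows d.fst d.snd (M.tourStep T d).snd := by
      rw [tourStep_of_not_adj hadj]
      exact S.follows_next d
    have hfst : (M.tourStep T d).fst = d.fst := by
      rw [tourStep_of_not_adj hadj]
      exact M.next_fst _
    have h0 : S.pos d.fst (M.tourStep T d).snd = S.pos d.fst d.snd + 1 := by
      rcases S.pos_of_follows hF with h2 | ⟨h2, h3⟩
      · exact h2.2
      · by_cases hr : d.fst = T.root
        · rw [hr] at hfst h3
          exact absurd (hext _ hfst h3) hd
        · exact absurd (S.eq_parent_of_pos hr d.adj h2).1.symm hadj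
    have hc : ¬ T.IsParent d.fst d.snd := fun h => hadj h.1
    rw [Reached, Reached, hfst, h0, List.lt_concat_succ_iff]
    simp only [hc, false_and, or_false, or_iff_left_iff_imp]
    -- A node whose key extends the key of `d.fst` by this position would lie below a child there,
    -- but the dart is not in the tree.
    intro h
    obtain ⟨a, -, ha⟩ := S.exists_isAncestor_of_prefix h
    rcases S.eq_root_or_isParent a with rfl | ⟨p, hp⟩
    · simp [S.key_root] at ha
    · rw [S.key_eq hp] at ha
      obtain ⟨h1, h2⟩ := List.append_inj' ha rfl
      rw [S.key_injective h1] at hp h2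
      rw [S.pos_injective hp.adj d.adj (by simpa using h2)] at hp
      exact absurd hp hc

variable (ho : ∀ v, M.IsOrderlyNode T v)

include ho

/-- While the darts at a node are scanned, its parent and its B₂ are reached and its B₄ is not; only
the status of the children changes. This is why the tests below ask for children separately. -/
theorem reached_iff {d : M.graph.Dart} {x : V} (hx : M.graph.Adj d.fst x)
    (hc : ¬ T.IsParent d.fst x) : S.Reached d x ↔ d.fst ∉ M.B₂ T x := by
  have hle : ∀ {l}, l < S.key d.fst → l < S.key d.fst ++ [S.pos d.fst d.snd] := fun h =>
    h.trans (List.lt_iff_exists_prefix.mpr (.inl ⟨List.prefix_append _ _, by simp⟩))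
  rcases S.kind ho hx with h | h | h | h
  · exact iff_of_true (hle (S.key_lt_of_isParent h)) fun h' => S.not_isParent_of_mem_B₂' h' h
  · exact iff_of_true (hle (S.key_lt_of_mem_B₂ h)) fun h' =>
      lt_asymm (S.key_lt_of_mem_B₂ h) (S.key_lt_of_mem_B₂ h')
  · exact absurd h hc
  · refine iff_of_false (fun h' => ?_) (not_not.mpr h)
    obtain ⟨-, h1, h2⟩ := S.mem_B₂_iff.mp h
    have := List.append_lt_append_of_not_prefix h1 h2 [S.pos d.fst d.snd] []
    rw [List.append_nil] at this
    exact lt_asymm h' this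

/-- The successor of the last node of B₂ is a child or lies in B₄. It cannot be the parent, which is
reached and would spoil the test, because the neighbor before the parent lies in B₄. That argument
fails only at `S.last`, hence `hl`. The test for B₄ has no such exception: its predecessor may well
be the parent. -/
theorem isLastInBlock_iff_reached {d : M.graph.Dart} (h : ¬ T.tree.Adj d.fst d.snd)
    (hl : d.fst ≠ S.last) :
    M.IsLastInBlock d.fst (M.B₂ T d.fst) d.snd ↔
      S.Reached d d.snd ∧
        (T.IsParent d.fst (M.next d).snd ∨ ¬ S.Reached d (M.next d).snd) := by
  have hF := S.follows_next d
  have hc : ¬ T.IsParent d.fst d.snd := fun h' => h h'.1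
  have hmem : S.Reached d d.snd ↔ d.snd ∈ M.B₂ T d.fst := by
    rw [S.reached_iff ho d.adj hc]
    rcases S.kind ho d.adj with h1 | h1 | h1 | h1
    · exact absurd h1.1.symm h
    · exact iff_of_true (fun h' => lt_asymm (S.key_lt_of_mem_B₂ h1) (S.key_lt_of_mem_B₂ h')) h1
    · exact absurd h1 hc
    · exact iff_of_false (not_not.mpr h1)
        (fun h' => lt_asymm (S.key_lt_of_mem_B₂ h1) (S.key_lt_of_mem_B₂ h'))
  have hlast : M.IsLastInBlock d.fst (M.B₂ T d.fst) d.snd ↔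
      d.snd ∈ M.B₂ T d.fst ∧ (M.next d).snd ∉ M.B₂ T d.fst := by
    constructor
    · rintro ⟨e, he, he', h1, h2⟩
      rw [RotationSystem.dart_ext he he'] at h2
      exact ⟨h1, h2⟩
    · rintro ⟨h1, h2⟩
      exact ⟨d, rfl, rfl, h1, h2⟩
  rw [hlast, hmem]
  refine and_congr_right fun h1 => ?_
  by_cases hc' : T.IsParent d.fst (M.next d).snd
  · exact iff_of_true (fun h' => S.not_isParent_of_mem_B₂' h' hc') (.inl hc')
  · rw [S.reached_iff ho hF.adj_right hc', not_not, or_iff_right hc']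
    rcases S.kind ho hF.adj_right with h2 | h2 | h2 | h2
    · exact absurd (S.mem_B₄_of_follows_parent ho h2 hl hF)
        fun h' => lt_asymm (S.key_lt_of_mem_B₂ h1) (S.key_lt_of_mem_B₂ h')
    · exact iff_of_false (not_not.mpr h2)
        fun h' => lt_asymm (S.key_lt_of_mem_B₂ h2) (S.key_lt_of_mem_B₂ h')
    · exact absurd h2 hc'
    · exact iff_of_true
        (fun h' => lt_asymm (S.key_lt_of_mem_B₂ h2) (S.key_lt_of_mem_B₂ h')) h2

theorem isFirstInBlock_iff_reached {d : M.graph.Dart} (h : ¬ T.tree.Adj d.fst d.snd) :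
    M.IsFirstInBlock d.fst (M.B₄ T d.fst) d.snd ↔
      ¬ S.Reached d d.snd ∧
        (T.IsParent d.fst (M.next⁻¹ d).snd ∨ S.Reached d (M.next⁻¹ d).snd) := by
  have hF := S.follows_prev d
  have hc : ¬ T.IsParent d.fst d.snd := fun h' => h h'.1
  have hfirst : M.IsFirstInBlock d.fst (M.B₄ T d.fst) d.snd ↔
      d.fst ∈ M.B₂ T d.snd ∧ d.fst ∉ M.B₂ T (M.next⁻¹ d).snd := by
    constructor
    · rintro ⟨e, he, he', h1, h2⟩
      rw [RotationSystem.dart_ext he he'] at h2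
      exact ⟨S.mem_B₄_iff.mp h1, fun h' => h2 (S.mem_B₄_iff.mpr h')⟩
    · rintro ⟨h1, h2⟩
      exact ⟨d, rfl, rfl, S.mem_B₄_iff.mpr h1, fun h' => h2 (S.mem_B₄_iff.mp h')⟩
  rw [hfirst, S.reached_iff ho d.adj hc, not_not]
  refine and_congr_right fun h1 => ?_
  by_cases hc' : T.IsParent d.fst (M.next⁻¹ d).snd
  · exact iff_of_true (fun h' => S.not_isParent_of_mem_B₂ h' hc') (.inl hc')
  · rw [S.reached_iff ho hF.adj_left hc', or_iff_right hc']

end Tour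

end PlaneGraph

/-! ### Evaluation and running time of programs. -/

namespace RAM

namespace Program

/-- Sequential composition of a list of programs. -/
def block : List Program → Program
  | [] => skip
  | p :: l => seq p (block l)

/-- An upper bound for the running time of a program without loops. -/
def size : Program → ℕ
  | seq p q => p.size + q.size
  | ite _ p q => p.size + q.size + 1
  | _ => 1

def LoopFree : Program → Prop
  | seq p q => p.LoopFree ∧ q.LoopFree
  | ite _ p q => p.LoopFree ∧ q.LoopFree
  | loop _ _ => False
  | _ => True

/-- The program does not write to the register `r`. -/
def KeepsReg (r : ℕ) : Program → Prop
  | const x _ => r ≠ x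
  | copy x _ => r ≠ x
  | inc x => r ≠ x
  | dec x => r ≠ x
  | load x _ _ => r ≠ x
  | seq p q => p.KeepsReg r ∧ q.KeepsReg r
  | ite _ p q => p.KeepsReg r ∧ q.KeepsReg r
  | loop _ p => p.KeepsReg r
  | _ => True

/-- The program does not write to the array `m`. -/
def KeepsMem (m : ℕ) : Program → Prop
  | store a _ _ => m ≠ a
  | seq p q => p.KeepsMem m ∧ q.KeepsMem m
  | ite _ p q => p.KeepsMem m ∧ q.KeepsMem m
  | loop _ p => p.KeepsMem m
  | _ => True

open Classical in
/-- The final state of a program without loops. -/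
noncomputable def eval : Program → State → State
  | skip, s => s
  | const x k, s => s.setReg x k
  | copy x y, s => s.setReg x (s.reg y)
  | inc x, s => s.setReg x (s.reg x + 1)
  | dec x, s => s.setReg x (s.reg x - 1)
  | load x a y, s => s.setReg x (s.mem a (s.reg y))
  | store a y x, s => s.setMem a (s.reg y) (s.reg x)
  | seq p q, s => q.eval (p.eval s)
  | ite b p q, s => if b.Holds s then p.eval s else q.eval s
  | loop _ _, s => s

theorem exec_eval {p : Program} (h : p.LoopFree) (s : State) :
    ∃ t ≤ p.size, Exec p s t (p.eval s) := by
  induction p generalizing s with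
  | skip => exact ⟨1, le_rfl, .skip s⟩
  | const x k => exact ⟨1, le_rfl, .const s x k⟩
  | copy x y => exact ⟨1, le_rfl, .copy s x y⟩
  | inc x => exact ⟨1, le_rfl, .inc s x⟩
  | dec x => exact ⟨1, le_rfl, .dec s x⟩
  | load x a y => exact ⟨1, le_rfl, .load s x a y⟩
  | store a y x => exact ⟨1, le_rfl, .store s a y x⟩
  | seq p q ihp ihq =>
    obtain ⟨t, ht, h1⟩ := ihp h.1 s
    obtain ⟨t', ht', h2⟩ := ihq h.2 (p.eval s)
    exact ⟨t + t', add_le_add ht ht', .seq h1 h2⟩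
  | ite b p q ihp ihq =>
    rw [eval, size]
    by_cases hb : b.Holds s
    · obtain ⟨t, ht, h1⟩ := ihp h.1 s
      rw [if_pos hb]
      exact ⟨t + 1, by omega, .ite_true hb h1⟩
    · obtain ⟨t, ht, h1⟩ := ihq h.2 s
      rw [if_neg hb]
      exact ⟨t + 1, by omega, .ite_false hb h1⟩
  | loop b p => exact h.elim

theorem eval_reg {r : ℕ} {p : Program} (h : p.KeepsReg r) (s : State) :
    (p.eval s).reg r = s.reg r := by
  induction p generalizing s with
  | const x k => exact Function.update_of_ne h _ _
  | copy x y => exact Function.update_of_ne h _ _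
  | inc x => exact Function.update_of_ne h _ _
  | dec x => exact Function.update_of_ne h _ _
  | load x a y => exact Function.update_of_ne h _ _
  | seq p q ihp ihq => exact (ihq h.2 _).trans (ihp h.1 s)
  | ite b p q ihp ihq =>
    rw [eval]
    split_ifs
    · exact ihp h.1 s
    · exact ihq h.2 s
  | _ => rfl

theorem eval_mem {m : ℕ} {p : Program} (h : p.KeepsMem m) (s : State) :
    (p.eval s).mem m = s.mem m := by
  induction p generalizing s with
  | store a y x => exact Function.update_of_ne h _ _
  | seq p q ihp ihq => exact (ihq h.2 _).trans (ihp h.1 s)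
  | ite b p q ihp ihq =>
    rw [eval]
    split_ifs
    · exact ihp h.1 s
    · exact ihq h.2 s
  | _ => rfl

end Program

/-- The invariant carries the round number, so the number of rounds is exactly `N`; each costs its
body and one test, and one further test ends the loop. -/
theorem exec_loop {b : Test} {p : Program} {c N : ℕ} {I : ℕ → State → Prop}
    (step : ∀ k < N, ∀ s, I k s → b.Holds s ∧ ∃ t ≤ c, ∃ s', Exec p s t s' ∧ I (k + 1) s')
    (terminates : ∀ s, I N s → ¬ b.Holds s) {s : State} (h : I 0 s) :
    ∃ t ≤ N * (c + 1) + 1, ∃ s', Exec (.loop b p) s t s' ∧ I N s' := by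
  induction N generalizing I s with
  | zero => exact ⟨1, by omega, s, .loop_false (terminates s h), h⟩
  | succ N ih =>
    obtain ⟨hb, t, ht, s', he, hI⟩ := step 0 (Nat.succ_pos N) s h
    obtain ⟨t', ht', s'', he', hI'⟩ := ih (I := fun k => I (k + 1))
      (fun k hk => step (k + 1) (Nat.succ_lt_succ hk)) terminates hI
    refine ⟨t + t' + 1, ?_, s'', .loop_true hb he he', hI'⟩
    rw [Nat.succ_mul]
    omega

end RAM

open RAM RAM.Program

theorem RepresentsInput.congr {n D : ℕ} {M : PlaneGraph (Fin n)} {T : RootedSubtree M.graph}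
    {num : M.graph.Dart ≃ Fin D} {s s' : State} (h : RepresentsInput M T num s)
    (hr : ∀ x < 3, s'.reg x = s.reg x) (hm : ∀ a < 6, s'.mem a = s.mem a) :
    RepresentsInput M T num s' where
  size := by rw [hr 0 (by norm_num)]; exact h.size
  outer := by rw [hr 1 (by norm_num)]; exact h.outer
  first := by rw [hm 0 (by norm_num)]; exact h.first
  neighbor := by rw [hm 1 (by norm_num)]; exact h.neighbor
  next := by rw [hm 2 (by norm_num)]; exact h.next
  prev := by rw [hm 3 (by norm_num)]; exact h.prev
  twin := by rw [hm 4 (by norm_num)]; exact h.twin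
  tree := by rw [hr 2 (by norm_num), hm 5 (by norm_num)]; exact h.tree

/-- The marker `n` differs from every node, so a single comparison decides parenthood. -/
theorem RepresentsTree.parent_eq_iff {n : ℕ} {G : SimpleGraph (Fin n)} {T : RootedSubtree G}
    {root : ℕ} {parent : ℕ → ℕ} (h : RepresentsTree T root parent) {u v : Fin n} :
    parent v = u ↔ T.IsParent u v := by
  refine ⟨fun h' => ?_, h.parent_eq u v⟩
  by_cases hex : ∃ w, T.IsParent w v
  · obtain ⟨w, hw⟩ := hex
    rw [h.parent_eq w v hw] at h'
    rwa [← Fin.ext h']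
  · rw [h.parent_none v hex] at h'
    exact absurd h' u.2.ne'

/-! ### The program and its correctness. -/

namespace RealizerProgram

/-- Array 9 holds the marks; it has to be cleared because the initial memory is arbitrary. Array 6
receives a copy of the parents in `T`. -/
def initStep : Program := block [.load 14 5 20, .store 6 20 14, .store 9 20 23, .inc 20]

def setup : Program := block [.const 20 0, .const 13 1, .const 23 0]

/-- Moves from the current external dart to the next one, unless it starts at the root. -/
def advance : Program := .ite (.ne 7 2) (block [.load 6 3 9, .load 9 4 6, .load 7 1 9]) .skip

/-- Finds the external dart that starts at the root, and prepares the traversal. -/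
def locate : Program := block [.copy 6 1, .load 9 4 6, .load 7 1 9, advance, advance]

def begin : Program :=
  block [.load 22 1 6, .load 12 2 6, .load 21 1 12, .store 9 2 13, .copy 6 12]

/-- A node with the number in register 15 that is unrelated to the node `v` with the number in
register 7 is compared with `v`. -/
def inspect : Program := block [.load 16 5 15, .load 17 9 15]

/-- One step of the depth-first traversal; register 6 holds the current dart. -/
def tourStep : Program := block [
  .load 8 1 6, .load 9 4 6, .load 7 1 9, .load 10 5 8, .load 11 5 7,
  .ite (.eq 10 7) (block [.store 9 8 13, .load 6 2 9])
    (.ite (.eq 11 8) (.load 6 2 9)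
      (block [.load 18 2 6, .load 14 9 8,
        .ite (.eq 14 13)
          (block [.load 15 1 18, inspect,
            .ite (.eq 16 7) (.store 7 7 8) (.ite (.ne 17 13) (.store 7 7 8) .skip)])
          (block [.load 19 3 6, .load 15 1 19, inspect,
            .ite (.eq 16 7) (.store 8 7 8) (.ite (.eq 17 13) (.store 8 7 8) .skip)]),
        .copy 6 18]))]

/-- The external nodes get the marker for "no parent" in all three output arrays. The root already
has it in array 6, which was copied from `T`. -/
def finish : Program := block [
  .store 6 21 0, .store 6 22 0,
  .store 7 2 0, .store 7 21 0, .store 7 22 0,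
  .store 8 2 0, .store 8 21 0, .store 8 22 0,
  .copy 3 2, .copy 4 21, .copy 5 22]

variable {n D : ℕ} {M : PlaneGraph (Fin n)} {T : RootedSubtree M.graph}
  {num : M.graph.Dart ≃ Fin D}

section TourStep

variable {s : State} (hin : RepresentsInput M T num s) {d : M.graph.Dart}
  (hd : s.reg 6 = num d) (hone : s.reg 13 = 1)

include hin hd hone

theorem eval_tourStep_of_isParent (h : T.IsParent d.fst d.snd) :
    (tourStep.eval s).reg 6 = num (M.next d.symm) ∧
      (tourStep.eval s).mem 9 = Function.update (s.mem 9) d.snd 1 ∧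
      (tourStep.eval s).mem 7 = s.mem 7 ∧ (tourStep.eval s).mem 8 = s.mem 8 := by
  have h1 : s.mem 5 (d.snd : Fin n) = (d.fst : Fin n) := hin.tree.parent_eq_iff.mpr h
  simp [tourStep, block, eval, State.setReg, State.setMem, Test.Holds, hd, hone, hin.neighbor,
    hin.twin, hin.next, h1]

omit hone in
theorem eval_tourStep_of_isParent' (h : T.IsParent d.snd d.fst) :
    (tourStep.eval s).reg 6 = num (M.next d.symm) ∧
      (tourStep.eval s).mem 9 = s.mem 9 ∧
      (tourStep.eval s).mem 7 = s.mem 7 ∧ (tourStep.eval s).mem 8 = s.mem 8 := by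
  have h1 : s.mem 5 (d.fst : Fin n) = (d.snd : Fin n) := hin.tree.parent_eq_iff.mpr h
  have h0 : s.mem 5 (d.snd : Fin n) ≠ (d.fst : Fin n) := fun h' =>
    h.asymm (hin.tree.parent_eq_iff.mp h')
  simp [tourStep, block, eval, State.setReg, Test.Holds, hd, hin.neighbor,
    hin.twin, hin.next, h0, h1]

open Classical in
theorem eval_tourStep_of_not_adj (h : ¬ T.tree.Adj d.fst d.snd) :
    (tourStep.eval s).reg 6 = num (M.next d) ∧
      (tourStep.eval s).mem 9 = s.mem 9 ∧
      (tourStep.eval s).mem 7 =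
        (if s.mem 9 d.snd = 1 ∧
            (T.IsParent d.fst (M.next d).snd ∨ s.mem 9 (M.next d).snd ≠ 1) then
          Function.update (s.mem 7) d.fst d.snd else s.mem 7) ∧
      (tourStep.eval s).mem 8 =
        (if s.mem 9 d.snd ≠ 1 ∧
            (T.IsParent d.fst (M.next⁻¹ d).snd ∨ s.mem 9 (M.next⁻¹ d).snd = 1) then
          Function.update (s.mem 8) d.fst d.snd else s.mem 8) := by
  have h0 : s.mem 5 (d.snd : Fin n) ≠ (d.fst : Fin n) := fun h' =>
    h (hin.tree.parent_eq_iff.mp h').1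
  have h1 : s.mem 5 (d.fst : Fin n) ≠ (d.snd : Fin n) := fun h' =>
    h (hin.tree.parent_eq_iff.mp h').1.symm
  have h2 : s.mem 1 (num d.symm) = (d.fst : Fin n) := hin.neighbor d.symm
  have h3 : s.mem 2 (num d) = num (M.next d) := hin.next d
  have h4 : s.mem 3 (num d) = num (M.next⁻¹ d) := hin.prev d
  rw [← hin.tree.parent_eq_iff, ← hin.tree.parent_eq_iff]
  have h5 : s.mem 1 (num (M.next d)) = ((M.next d).snd : Fin n) := hin.neighbor _
  have h6 : s.mem 1 (num (M.next⁻¹ d)) = ((M.next⁻¹ d).snd : Fin n) := hin.neighbor _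
  have h7 : s.mem 1 (num d) = (d.snd : Fin n) := hin.neighbor _
  have h8 : s.mem 4 (num d) = num d.symm := hin.twin _
  generalize (M.next d).snd = a at *
  generalize (M.next⁻¹ d).snd = b at *
  generalize M.next⁻¹ d = d' at *
  by_cases c1 : s.mem 9 (d.snd : Fin n) = 1
  · by_cases c2 : s.mem 5 (a : Fin n) = (d.fst : Fin n)
    · simp [tourStep, inspect, block, eval, State.setReg, State.setMem, Test.Holds, hd, hone,
        h0, h1, h2, h3, h5, h7, h8, c1, c2]
    · by_cases c3 : s.mem 9 (a : Fin n) = 1 <;>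
      simp [tourStep, inspect, block, eval, State.setReg, State.setMem, Test.Holds, hd, hone,
        h0, h1, h2, h3, h5, h7, h8, c1, c2, c3]
  · by_cases c2 : s.mem 5 (b : Fin n) = (d.fst : Fin n)
    · simp [tourStep, inspect, block, eval, State.setReg, State.setMem, Test.Holds, hd, hone,
        h0, h1, h2, h3, h4, h6, h7, h8, c1, c2]
    · by_cases c3 : s.mem 9 (b : Fin n) = 1 <;>
      simp [tourStep, inspect, block, eval, State.setReg, State.setMem, Test.Holds, hd, hone,
        h0, h1, h2, h3, h4, h6, h7, h8, c1, c2, c3]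

end TourStep

end RealizerProgram

namespace RealizerProgram

variable {n D : ℕ} {M : PlaneGraph (Fin n)} {T : RootedSubtree M.graph}
  {num : M.graph.Dart ≃ Fin D}

/-- The arrays after the first `k` rounds of the initialization. -/
structure Initialized (num : M.graph.Dart ≃ Fin D) (k : ℕ) (s : State) : Prop where
  input : RepresentsInput M T num s
  one : s.reg 13 = 1
  parent : ∀ v : Fin n, v < k → s.mem 6 v = s.mem 5 v
  unmarked : ∀ v : Fin n, v < k → s.mem 9 v = 0

theorem exec_initialization {s : State} (h : RepresentsInput M T num s) :
    ∃ t ≤ setup.size + (n * (initStep.size + 1) + 1), ∃ s',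
      Exec (setup.seq (.loop (.lt 20 0) initStep)) s t s' ∧ Initialized (T := T) num n s' := by
  obtain ⟨t, ht, he⟩ := exec_eval (p := setup) (by simp [setup, block, LoopFree]) s
  have hloop := exec_loop (b := .lt 20 0) (p := initStep) (c := initStep.size) (N := n)
    (I := fun k s => Initialized (T := T) num k s ∧ s.reg 20 = k ∧ s.reg 23 = 0)
    (s := setup.eval s) ?_ ?_ ?_
  · obtain ⟨t', ht', s', he', hI, -, -⟩ := hloop
    exact ⟨t + t', add_le_add ht ht', s', .seq he he', hI⟩
  · rintro k hk s ⟨hI, hk', h0⟩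
    have hsize := hI.input.size
    refine ⟨by change s.reg 20 < s.reg 0; omega, ?_⟩
    obtain ⟨t, ht, he⟩ := exec_eval (p := initStep) (by simp [initStep, block, LoopFree]) s
    refine ⟨t, ht, _, he, ⟨?_, ?_, ?_, ?_⟩, ?_, ?_⟩
    · refine hI.input.congr (fun x hx => eval_reg ?_ s) (fun a ha => eval_mem ?_ s)
      · simp only [initStep, block, KeepsReg, and_true, true_and]; omega
      · simp only [initStep, block, KeepsMem, and_true, true_and]; omega
    · rw [eval_reg (by simp [initStep, block, KeepsReg]), hI.one]
    · intro v hv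
      have h1 : (initStep.eval s).mem 6 = Function.update (s.mem 6) k (s.mem 5 k) := by
        simp [initStep, block, eval, State.setReg, State.setMem, hk']
      rw [h1, eval_mem (by simp [initStep, block, KeepsMem]), Function.update_apply]
      rcases Nat.lt_succ_iff_lt_or_eq.mp hv with h2 | h2
      · rw [if_neg h2.ne, hI.parent v h2]
      · rw [if_pos h2, h2]
    · intro v hv
      have h1 : (initStep.eval s).mem 9 = Function.update (s.mem 9) k 0 := by
        simp [initStep, block, eval, State.setReg, State.setMem, hk', h0]
      rw [h1, Function.update_apply]
      rcases Nat.lt_succ_iff_lt_or_eq.mp hv with h2 | h2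
      · rw [if_neg h2.ne, hI.unmarked v h2]
      · rw [if_pos h2]
    · simp [initStep, block, eval, State.setReg, State.setMem, hk']
    · rw [eval_reg (by simp [initStep, block, KeepsReg]), h0]
  · rintro s ⟨hI, hk', -⟩
    have hsize := hI.input.size
    change ¬ s.reg 20 < s.reg 0
    omega
  · refine ⟨⟨?_, ?_, fun v hv => absurd hv (Nat.not_lt_zero _),
      fun v hv => absurd hv (Nat.not_lt_zero _)⟩, ?_, ?_⟩
    · refine h.congr (fun x hx => eval_reg ?_ s) (fun a ha => eval_mem ?_ s)
      · simp only [setup, block, KeepsReg, and_true]; omega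
      · simp only [setup, block, KeepsMem, and_true]
    all_goals simp [setup, block, eval, State.setReg]

theorem Initialized.eval {k : ℕ} {s : State} (h : Initialized (T := T) num k s) {p : Program}
    (hr : ∀ x, x < 3 ∨ x = 13 → p.KeepsReg x) (hm : ∀ a, a < 7 ∨ a = 9 → p.KeepsMem a) :
    Initialized (T := T) num k (p.eval s) where
  input := h.input.congr (fun x hx => eval_reg (hr x (.inl hx)) s)
    (fun a ha => eval_mem (hm a (.inl (by omega))) s)
  one := by rw [eval_reg (hr _ (.inr rfl)), h.one]
  parent := by
    rw [eval_mem (hm 6 (.inl (by norm_num))), eval_mem (hm 5 (.inl (by norm_num)))]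
    exact h.parent
  unmarked := by
    rw [eval_mem (hm 9 (.inr rfl))]
    exact h.unmarked

/-- The dart `d` is at hand. -/
def AtDart (num : M.graph.Dart ≃ Fin D) (d : M.graph.Dart) (s : State) : Prop :=
  s.reg 6 = num d ∧ s.reg 9 = num d.symm ∧ s.reg 7 = (d.fst : Fin n)

theorem eval_advance {s : State} {d : M.graph.Dart} (hin : RepresentsInput M T num s)
    (h : AtDart num d s) :
    (d.fst = T.root → AtDart num d (advance.eval s)) ∧
      (d.fst ≠ T.root → AtDart num (M.facePerm d) (advance.eval s)) := by
  obtain ⟨h1, h2, h3⟩ := h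
  have hroot := hin.tree.root_eq
  constructor
  · intro hd
    have : ¬ Test.Holds s (.ne 7 2) := by
      change ¬ s.reg 7 ≠ s.reg 2
      rw [h3, hroot, hd, not_not]
    rw [advance, eval, if_neg this]
    exact ⟨h1, h2, h3⟩
  · intro hd
    have : Test.Holds s (.ne 7 2) := by
      change s.reg 7 ≠ s.reg 2
      rw [h3, hroot]
      exact fun h => hd (Fin.ext h)
    have h4 : s.mem 3 (num d.symm) = num (M.facePerm d) := hin.prev d.symm
    have h5 : s.mem 4 (num (M.facePerm d)) = num (M.facePerm d).symm := hin.twin _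
    have h6 : s.mem 1 (num (M.facePerm d).symm) = ((M.facePerm d).fst : Fin n) := hin.neighbor _
    rw [advance, eval, if_pos this]
    simp [AtDart, block, eval, State.setReg, h2, h4, h5, h6]

theorem eval_locate (S : M.Tour T) {s : State} (h : Initialized (T := T) num n s) :
    Initialized (T := T) num n (locate.eval s) ∧
      (locate.eval s).reg 6 = num (M.next⁻¹ (S.start T.root)) := by
  have hkr : ∀ x, x < 3 ∨ x = 13 → locate.KeepsReg x := fun x hx => by
    simp only [locate, advance, block, KeepsReg, and_true]
    omega
  have hkm : ∀ a, a < 7 ∨ a = 9 → locate.KeepsMem a := fun x hx => by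
    simp only [locate, advance, block, KeepsMem, and_true]
  refine ⟨h.eval hkr hkm, ?_⟩
  let p : Program := .seq (.copy 6 1) (.seq (.load 9 4 6) (.load 7 1 9))
  have hp : RepresentsInput M T num (p.eval s) := by
    refine h.input.congr (fun x hx => eval_reg ?_ s) (fun a ha => eval_mem ?_ s)
    · simp only [p, KeepsReg]; omega
    · simp only [p, KeepsMem, and_true]
  have hp' : RepresentsInput M T num (advance.eval (p.eval s)) := by
    refine hp.congr (fun x hx => eval_reg ?_ _) (fun a ha => eval_mem ?_ _)
    · simp only [advance, block, KeepsReg, and_true]; omega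
    · simp only [advance, block, KeepsMem, and_true]
  have heq : locate.eval s = advance.eval (advance.eval (p.eval s)) := rfl
  obtain ⟨d, hd, hd1⟩ := h.input.outer
  have h1 : AtDart num d (p.eval s) := by
    have h4 : s.mem 4 (num d) = num d.symm := h.input.twin d
    have h5 : s.mem 1 (num d.symm) = (d.fst : Fin n) := h.input.neighbor d.symm
    simp [AtDart, p, Program.eval, State.setReg, hd1, h4, h5]
  rw [heq]
  set e := M.next⁻¹ (S.start T.root) with he
  have he0 : e.fst = T.root := (RotationSystem.prev_fst _).trans (S.start_fst _)
  have he1 : (M.facePerm e).fst ≠ T.root := by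
    rw [RotationSystem.facePerm_fst, ← he0]
    exact e.snd_ne_fst
  have he2 : (M.facePerm (M.facePerm e)).fst ≠ T.root := by
    have := (M.facePerm (M.facePerm e)).fst_ne_snd
    rwa [← RotationSystem.facePerm_fst (M.facePerm (M.facePerm e)), S.triangle, he0] at this
  -- The given external dart is one of three, so the one at the root is at most two moves away;
  -- `advance` is idle once it is found.
  rw [← S.prev_outer, RotationSystem.mem_face_iff S.triangle] at hd
  have key : AtDart num e (advance.eval (advance.eval (p.eval s))) := by
    rcases hd with rfl | rfl | rfl
    · exact (eval_advance hp' ((eval_advance hp h1).1 he0)).1 he0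
    · have := (eval_advance hp' ((eval_advance hp h1).2 he1)).2 he2
      rwa [S.triangle] at this
    · have := (eval_advance hp h1).2 he2
      rw [S.triangle] at this
      exact (eval_advance hp' this).1 he0
  exact key.1

/-- The state after `k` steps of the traversal. -/
structure Traversed (S : M.Tour T) (num : M.graph.Dart ≃ Fin D) (k : ℕ) (s : State) : Prop where
  input : RepresentsInput M T num s
  one : s.reg 13 = 1
  base : s.reg 12 = num (S.start T.root)
  first : s.reg 21 = S.first
  last : s.reg 22 = S.last
  cur : s.reg 6 = num ((M.tourStep T ^ k) (S.start T.root))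
  parent : ∀ v : Fin n, s.mem 6 v = s.mem 5 v
  -- After the last step the walk is back at its start, where `Reached` holds for the root only
  -- although every mark persists; hence `k < D`.
  reached : k < D → ∀ x : Fin n,
    s.mem 9 x = 1 ↔ S.Reached ((M.tourStep T ^ k) (S.start T.root)) x
  -- Restricted to internal nodes because the test for T₂ is not valid at `S.last`.
  complete₂ : ∀ j < k, ∀ d, (M.tourStep T ^ j) (S.start T.root) = d → M.IsInternalNode d.fst →
    M.IsLastInBlock d.fst (M.B₂ T d.fst) d.snd → s.mem 7 d.fst = d.snd
  completeₙ : ∀ j < k, ∀ d, (M.tourStep T ^ j) (S.start T.root) = d →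
    M.IsFirstInBlock d.fst (M.B₄ T d.fst) d.snd → s.mem 8 d.fst = d.snd

theorem eval_begin (S : M.Tour T) {s : State} (h : Initialized (T := T) num n s)
    (h6 : s.reg 6 = num (M.next⁻¹ (S.start T.root))) : Traversed S num 0 (begin.eval s) where
  input := by
    refine h.input.congr (fun x hx => eval_reg ?_ s) (fun a ha => eval_mem ?_ s)
    · simp only [begin, block, KeepsReg, and_true, true_and]; omega
    · simp only [begin, block, KeepsMem, and_true, true_and]; omega
  one := by rw [eval_reg (by simp [begin, block, KeepsReg]), h.one]
  base := by
    simp [begin, block, eval, State.setReg, State.setMem, h6, h.input.next]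
  first := by
    simp [begin, block, eval, State.setReg, State.setMem, h6, h.input.next, h.input.neighbor,
      PlaneGraph.Tour.first]
  last := by
    simp [begin, block, eval, State.setReg, State.setMem, h6, h.input.neighbor,
      PlaneGraph.Tour.last]
  cur := by
    simp [begin, block, eval, State.setReg, State.setMem, h6, h.input.next]
  parent := by
    rw [eval_mem (by simp [begin, block, KeepsMem]), eval_mem (by simp [begin, block, KeepsMem])]
    exact fun v => h.parent v v.2
  reached := by
    intro _ x
    rw [pow_zero, Equiv.Perm.one_apply, S.reached_start]
    have h1 := h.unmarked x x.2
    have h2 : (begin.eval s).mem 9 = Function.update (s.mem 9) T.root 1 := by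
      simp [begin, block, eval, State.setReg, State.setMem, h.one, h.input.tree.root_eq]
    rw [h2, Function.update_apply, h1]
    by_cases hx : x = T.root
    · simp [hx]
    · simp [hx, Fin.val_inj]
  complete₂ := fun j hj => absurd hj (Nat.not_lt_zero j)
  completeₙ := fun j hj => absurd hj (Nat.not_lt_zero j)

theorem eval_tourStep (S : M.Tour T) (ho : ∀ v, M.IsOrderlyNode T v) {k : ℕ} (hk : k < D)
    {s : State} (h : Traversed S num k s) : Traversed S num (k + 1) (tourStep.eval s) := by
  have hcard : Nat.card M.graph.Dart = D := by rw [Nat.card_congr num, Nat.card_fin]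
  obtain ⟨d, hd⟩ : ∃ d, (M.tourStep T ^ k) (S.start T.root) = d := ⟨_, rfl⟩
  have hnext : (M.tourStep T ^ (k + 1)) (S.start T.root) = M.tourStep T d := by
    rw [pow_succ', Equiv.Perm.mul_apply, hd]
  have hin := h.input
  have hcur := h.cur
  have hreached := h.reached hk
  rw [hd] at hcur hreached
  have hkr : ∀ x, x < 3 ∨ x = 12 ∨ x = 13 ∨ x = 21 ∨ x = 22 → tourStep.KeepsReg x := fun x hx => by
    simp only [tourStep, inspect, block, KeepsReg, and_true, true_and]
    omega
  have hkm : ∀ a < 7, tourStep.KeepsMem a := fun a ha => by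
    simp only [tourStep, inspect, block, KeepsMem, and_true, true_and]
    omega
  -- The effect of one step, whichever kind of dart is treated. An entry of the arrays 7 and 8 is
  -- written at the wanted dart and otherwise left alone, so a correct entry is never spoilt.
  have key : (tourStep.eval s).reg 6 = num (M.tourStep T d) ∧
      (k + 1 < D → ∀ x : Fin n, (tourStep.eval s).mem 9 x = 1 ↔ S.Reached (M.tourStep T d) x) ∧
      (∀ v : Fin n, M.IsInternalNode v →
        (M.IsLastInBlock v (M.B₂ T v) d.snd → d.fst = v → (tourStep.eval s).mem 7 v = d.snd) ∧
        ((d.fst = v → ¬ M.IsLastInBlock v (M.B₂ T v) d.snd) →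
          (tourStep.eval s).mem 7 v = s.mem 7 v)) ∧
      (∀ v : Fin n,
        (M.IsFirstInBlock v (M.B₄ T v) d.snd → d.fst = v → (tourStep.eval s).mem 8 v = d.snd) ∧
        ((d.fst = v → ¬ M.IsFirstInBlock v (M.B₄ T v) d.snd) →
          (tourStep.eval s).mem 8 v = s.mem 8 v)) := by
    have hstep : k + 1 < D → M.tourStep T d ≠ S.start T.root := fun hk' h' => by
      rw [← hnext, S.tourStep_pow_eq_iff, hcard] at h'
      exact absurd (Nat.le_of_dvd (Nat.succ_pos k) h') (by omega)
    by_cases hadj : T.tree.Adj d.fst d.snd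
    · have hnl : ∀ v, d.fst = v → ¬ M.IsLastInBlock v (M.B₂ T v) d.snd := by
        rintro v rfl h'
        have h1 := S.mem_B₂_of_isLastInBlock ho h'
        exact (T.isParent_or_of_adj hadj).elim (S.not_isParent_of_mem_B₂' h1)
          (S.not_isParent_of_mem_B₂ h1)
      have hnf : ∀ v, d.fst = v → ¬ M.IsFirstInBlock v (M.B₄ T v) d.snd := by
        rintro v rfl h'
        have h1 := S.mem_B₂_of_isFirstInBlock ho h'
        exact (T.isParent_or_of_adj hadj).elim (S.not_isParent_of_mem_B₂ h1)
          (S.not_isParent_of_mem_B₂' h1)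
      rcases T.isParent_or_of_adj hadj with hp | hp
      · obtain ⟨h1, h2, h3, h4⟩ := eval_tourStep_of_isParent hin hcur h.one hp
        rw [h1, h2, h3, h4, PlaneGraph.tourStep_of_adj hadj]
        refine ⟨rfl, fun hk' x => ?_, fun v _ => ⟨fun hl hv => absurd hl (hnl v hv), fun _ => rfl⟩,
          fun v => ⟨fun hl hv => absurd hl (hnf v hv), fun _ => rfl⟩⟩
        rw [← PlaneGraph.tourStep_of_adj hadj, S.reached_tourStep (hstep hk'), ← hreached,
          Function.update_apply]
        by_cases hx : x = d.snd
        · simp [hx, hp]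
        · have hx' : (x : ℕ) ≠ (d.snd : Fin n) := fun h' => hx (Fin.ext h')
          rw [if_neg hx', or_iff_left fun h' => hx h'.2]
      · obtain ⟨h1, h2, h3, h4⟩ := eval_tourStep_of_isParent' hin hcur hp
        rw [h1, h2, h3, h4, PlaneGraph.tourStep_of_adj hadj]
        refine ⟨rfl, fun hk' x => ?_, fun v _ => ⟨fun hl hv => absurd hl (hnl v hv), fun _ => rfl⟩,
          fun v => ⟨fun hl hv => absurd hl (hnf v hv), fun _ => rfl⟩⟩
        rw [← PlaneGraph.tourStep_of_adj hadj, S.reached_tourStep (hstep hk'), ← hreached,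
          or_iff_left fun h' => hp.asymm h'.1]
    · obtain ⟨h1, h2, h3, h4⟩ := eval_tourStep_of_not_adj hin hcur h.one hadj
      rw [h1, h2, h3, h4, PlaneGraph.tourStep_of_not_adj hadj]
      refine ⟨rfl, fun hk' x => ?_, fun v hv => ?_, fun v => ?_⟩
      · rw [← PlaneGraph.tourStep_of_not_adj hadj, S.reached_tourStep (hstep hk'), ← hreached,
          or_iff_left fun h' => hadj h'.1.1]
      · by_cases hdv : d.fst = v
        · subst hdv
          have hiff := S.isLastInBlock_iff_reached ho hadj (S.isInternalNode_iff.mp hv).2.2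
          rw [← hreached, ← hreached] at hiff
          constructor
          · intro hl _
            rw [if_pos (hiff.mp hl), Function.update_self]
          · intro hl
            rw [if_neg fun h' => hl rfl (hiff.mpr h')]
        · refine ⟨fun _ h' => absurd h' hdv, fun _ => ?_⟩
          split_ifs
          · rw [Function.update_of_ne fun h' => hdv (Fin.ext h'.symm)]
          · rfl
      · by_cases hdv : d.fst = v
        · subst hdv
          have hiff := S.isFirstInBlock_iff_reached ho hadj
          rw [← hreached, ← hreached] at hiff
          constructor
          · intro hl _
            rw [if_pos (hiff.mp hl), Function.update_self]
          · intro hl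
            rw [if_neg fun h' => hl rfl (hiff.mpr h')]
        · refine ⟨fun _ h' => absurd h' hdv, fun _ => ?_⟩
          split_ifs
          · rw [Function.update_of_ne fun h' => hdv (Fin.ext h'.symm)]
          · rfl
  obtain ⟨k1, k2, k3, k4⟩ := key
  constructor
  · exact hin.congr (fun x hx => eval_reg (hkr x (.inl hx)) s)
      (fun a ha => eval_mem (hkm a (by omega)) s)
  · rw [eval_reg (hkr _ (by norm_num)), h.one]
  · rw [eval_reg (hkr _ (by norm_num)), h.base]
  · rw [eval_reg (hkr _ (by norm_num)), h.first]
  · rw [eval_reg (hkr _ (by norm_num)), h.last]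
  · rw [hnext, k1]
  · rw [eval_mem (hkm 6 (by norm_num)), eval_mem (hkm 5 (by norm_num))]
    exact h.parent
  · rw [hnext]
    exact k2
  · intro j hj e he hi hl
    rcases Nat.lt_succ_iff_lt_or_eq.mp hj with hj | rfl
    · have h1 := h.complete₂ j hj e he hi hl
      by_cases h2 : d.fst = e.fst ∧ M.IsLastInBlock e.fst (M.B₂ T e.fst) d.snd
      · rw [(k3 _ hi).1 h2.2 h2.1, S.isLastInBlock_unique ho h2.2 hl]
      · rw [(k3 _ hi).2 fun h3 h4 => h2 ⟨h3, h4⟩, h1]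
    · rw [hd] at he
      subst he
      exact (k3 _ hi).1 hl rfl
  · intro j hj e he hl
    rcases Nat.lt_succ_iff_lt_or_eq.mp hj with hj | rfl
    · have h1 := h.completeₙ j hj e he hl
      by_cases h2 : d.fst = e.fst ∧ M.IsFirstInBlock e.fst (M.B₄ T e.fst) d.snd
      · rw [(k4 _).1 h2.2 h2.1, S.isFirstInBlock_unique ho h2.2 hl]
      · rw [(k4 _).2 fun h3 h4 => h2 ⟨h3, h4⟩, h1]
    · rw [hd] at he
      subst he
      exact (k4 _).1 hl rfl

/-- One step precedes the loop, because the loop test stops at the start dart. The walk is a single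
cycle of length `D`, so it returns there after exactly `D - 1` further steps. -/
theorem exec_traverse (S : M.Tour T) (ho : ∀ v, M.IsOrderlyNode T v) {s : State}
    (h : Traversed S num 0 s) :
    ∃ t ≤ tourStep.size + (D * (tourStep.size + 1) + 1), ∃ s',
      Exec (tourStep.seq (.loop (.ne 6 12) tourStep)) s t s' ∧ Traversed S num D s' := by
  have hcard : Nat.card M.graph.Dart = D := by rw [Nat.card_congr num, Nat.card_fin]
  have hlf : tourStep.LoopFree := by simp [tourStep, inspect, block, LoopFree]
  have hD : 0 < D := (Nat.zero_le _).trans_lt (num (S.start T.root)).2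
  obtain ⟨t, ht, he⟩ := exec_eval hlf s
  have hloop := exec_loop (b := .ne 6 12) (p := tourStep) (c := tourStep.size) (N := D - 1)
    (I := fun k s => Traversed S num (k + 1) s) (s := tourStep.eval s) ?_ ?_ ?_
  · obtain ⟨t', ht', s', he', hI⟩ := hloop
    rw [Nat.sub_add_cancel hD] at hI
    refine ⟨t + t', add_le_add ht (ht'.trans ?_), s', .seq he he', hI⟩
    gcongr
    exact Nat.sub_le D 1
  · intro k hk s hI
    refine ⟨?_, ?_⟩
    · change s.reg 6 ≠ s.reg 12
      rw [hI.cur, hI.base]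
      intro h'
      have h1 := num.injective (Fin.ext h')
      rw [S.tourStep_pow_eq_iff, hcard] at h1
      exact absurd (Nat.le_of_dvd (Nat.succ_pos k) h1) (by omega)
    · obtain ⟨t, ht, he⟩ := exec_eval hlf s
      exact ⟨t, ht, _, he, eval_tourStep S ho (by omega) hI⟩
  · intro s hI
    change ¬ s.reg 6 ≠ s.reg 12
    rw [Nat.sub_add_cancel hD] at hI
    rw [hI.cur, hI.base, not_not, S.tourStep_pow_eq_iff.mpr (by rw [hcard])]
  · exact eval_tourStep S ho hD h

theorem eval_finish (S : M.Tour T) (ho : ∀ v, M.IsOrderlyNode T v) {s : State}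
    (h : Traversed S num D s) {T₁ T₂ Tₙ : RootedSubtree M.graph}
    (h₁ : ∀ u v, T₁.IsParent u v ↔ M.IsInternalNode v ∧ T.IsParent u v)
    (h₂ : ∀ u v, T₂.IsParent u v ↔ M.IsInternalNode v ∧ M.IsLastInBlock v (M.B₂ T v) u)
    (hₙ : ∀ u v, Tₙ.IsParent u v ↔ M.IsInternalNode v ∧ M.IsFirstInBlock v (M.B₄ T v) u)
    (hr₁ : T₁.root = T.root) (hr₂ : T₂.root = S.first) (hrₙ : Tₙ.root = S.last) :
    RepresentsOutput T₁ T₂ Tₙ (finish.eval s) := by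
  have hcard : Nat.card M.graph.Dart = D := by rw [Nat.card_congr num, Nat.card_fin]
  have hsize := h.input.size
  have hroot := h.input.tree.root_eq
  have h6 : (finish.eval s).mem 6 =
      Function.update (Function.update (s.mem 6) S.first n) S.last n := by
    simp [finish, block, eval, State.setReg, State.setMem, h.first, h.last, hsize]
  have h7 : (finish.eval s).mem 7 =
      Function.update (Function.update (Function.update (s.mem 7) T.root n) S.first n)
        S.last n := by
    simp [finish, block, eval, State.setReg, State.setMem, h.first, h.last, hsize, hroot]
  have h8 : (finish.eval s).mem 8 =
      Function.update (Function.update (Function.update (s.mem 8) T.root n) S.first n)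
        S.last n := by
    simp [finish, block, eval, State.setReg, State.setMem, h.first, h.last, hsize, hroot]
  have hother : ∀ v : Fin n, ¬ M.IsInternalNode v → v = T.root ∨ v = S.first ∨ v = S.last := by
    intro v hv
    exact S.isExternalNode_iff.mp (not_not.mp hv)
  have hint₂ : ∀ v : Fin n, M.IsInternalNode v → (finish.eval s).mem 7 v = s.mem 7 v := by
    intro v hv
    obtain ⟨a, b, c⟩ := S.isInternalNode_iff.mp hv
    rw [h7, Function.update_of_ne (Fin.val_injective.ne c),
      Function.update_of_ne (Fin.val_injective.ne b),
      Function.update_of_ne (Fin.val_injective.ne a)]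
  have hintₙ : ∀ v : Fin n, M.IsInternalNode v → (finish.eval s).mem 8 v = s.mem 8 v := by
    intro v hv
    obtain ⟨a, b, c⟩ := S.isInternalNode_iff.mp hv
    rw [h8, Function.update_of_ne (Fin.val_injective.ne c),
      Function.update_of_ne (Fin.val_injective.ne b),
      Function.update_of_ne (Fin.val_injective.ne a)]
  refine ⟨⟨?_, ?_, ?_⟩, ⟨?_, ?_, ?_⟩, ⟨?_, ?_, ?_⟩⟩
  · rw [hr₁, ← hroot]
    simp [finish, block, eval, State.setReg, State.setMem]
  · intro u v huv
    obtain ⟨hv, hp⟩ := (h₁ u v).mp huv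
    obtain ⟨a, b, c⟩ := S.isInternalNode_iff.mp hv
    rw [h6, Function.update_of_ne (Fin.val_injective.ne c),
      Function.update_of_ne (Fin.val_injective.ne b), h.parent, h.input.tree.parent_eq u v hp]
  · intro v hv
    rw [h6, Function.update_apply, Function.update_apply]
    split_ifs with hl hf
    · rfl
    · rfl
    · rw [h.parent]
      refine h.input.tree.parent_none v ?_
      rintro ⟨u, hu⟩
      refine hv ⟨u, (h₁ u v).mpr ⟨S.isInternalNode_iff.mpr ⟨?_, fun e => hf (e ▸ rfl),
        fun e => hl (e ▸ rfl)⟩, hu⟩⟩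
      rintro rfl
      exact T.not_isParent_root _ hu
  · rw [hr₂, ← h.first]
    simp [finish, block, eval, State.setReg, State.setMem]
  · intro u v huv
    obtain ⟨hv, hp⟩ := (h₂ u v).mp huv
    have hadj := (S.mem_B₂_of_isLastInBlock ho hp).1
    -- The walk visits every dart, in particular the one from `v` to its new parent.
    obtain ⟨j, hj, hj'⟩ := S.exists_tourStep_pow_eq ⟨(v, u), hadj⟩
    rw [hint₂ v hv]
    exact h.complete₂ j (hcard ▸ hj) _ hj' hv hp
  · intro v hv
    have hv' : ¬ M.IsInternalNode v := fun hi => by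
      obtain ⟨a, b, -⟩ := S.isInternalNode_iff.mp hi
      obtain ⟨w, hw⟩ := S.exists_isLastInBlock ho a b
      exact hv ⟨w, (h₂ w v).mpr ⟨hi, hw⟩⟩
    rw [h7]
    rcases hother v hv' with rfl | rfl | rfl <;> simp [Function.update_apply]
  · rw [hrₙ, ← h.last]
    simp [finish, block, eval, State.setReg, State.setMem]
  · intro u v huv
    obtain ⟨hv, hp⟩ := (hₙ u v).mp huv
    have hadj := (S.mem_B₂_of_isFirstInBlock ho hp).1.symm
    obtain ⟨j, hj, hj'⟩ := S.exists_tourStep_pow_eq ⟨(v, u), hadj⟩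
    rw [hintₙ v hv]
    exact h.completeₙ j (hcard ▸ hj) _ hj' hp
  · intro v hv
    have hv' : ¬ M.IsInternalNode v := fun hi => by
      obtain ⟨a, -, b⟩ := S.isInternalNode_iff.mp hi
      obtain ⟨w, hw⟩ := S.exists_isFirstInBlock ho a b
      exact hv ⟨w, (hₙ w v).mpr ⟨hi, hw⟩⟩
    rw [h8]
    rcases hother v hv' with rfl | rfl | rfl <;> simp [Function.update_apply]

/-- The number of steps of `computeRealizer` per node. -/
def timeFactor : ℕ :=
  setup.size + initStep.size + 2 + locate.size + begin.size +
    (tourStep.size + 6 * (tourStep.size + 1) + 1) + finish.size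

def computeRealizer : Program :=
  .seq (.seq setup (.loop (.lt 20 0) initStep))
    (.seq locate (.seq begin (.seq (.seq tourStep (.loop (.ne 6 12) tourStep)) finish)))

theorem exec_computeRealizer (S : M.Tour T) (ho : ∀ v, M.IsOrderlyNode T v) {s : State}
    (h : RepresentsInput M T num s) :
    ∃ t ≤ timeFactor * n, ∃ s', Exec computeRealizer s t (finish.eval s') ∧
      Traversed S num D s' := by
  obtain ⟨t₁, ht₁, s₁, e₁, hs₁⟩ := exec_initialization h
  obtain ⟨t₂, ht₂, e₂⟩ := exec_eval (p := locate)
    (by simp [locate, advance, block, LoopFree]) s₁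
  obtain ⟨hs₂, hc⟩ := eval_locate S hs₁
  obtain ⟨t₃, ht₃, e₃⟩ := exec_eval (p := begin)
    (by simp [begin, block, LoopFree]) (locate.eval s₁)
  obtain ⟨t₄, ht₄, s₄, e₄, hs₄⟩ := exec_traverse S ho (eval_begin S hs₂ hc)
  obtain ⟨t₅, ht₅, e₅⟩ := exec_eval (p := finish) (by simp [finish, block, LoopFree]) s₄
  refine ⟨_, ?_, s₄, .seq e₁ (.seq e₂ (.seq e₃ (.seq e₄ e₅))), hs₄⟩
  have hn : 1 ≤ n := (Nat.zero_le _).trans_lt T.root.2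
  -- The number of darts is 2(3n - 6). The costs that do not depend on `n` are absorbed by `n ≥ 1`.
  have hD : D ≤ 6 * n := by
    have hcard : Nat.card M.graph.Dart = D := by rw [Nat.card_congr num, Nat.card_fin]
    have h1 := M.card_dart
    have h2 := M.card_edges S.triangle
    rw [Nat.card_fin] at h2
    omega
  have h4 : t₄ ≤ tourStep.size + ((6 * n) * (tourStep.size + 1) + 1) := by
    refine ht₄.trans ?_
    gcongr
  rw [timeFactor]
  generalize setup.size = a at *
  generalize initStep.size = b at *
  generalize locate.size = c at *
  generalize begin.size = e at *
  generalize tourStep.size = f at *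
  generalize finish.size = g at *
  obtain ⟨m, rfl⟩ := Nat.exists_eq_add_of_le' hn
  nlinarith [Nat.zero_le (m * a), Nat.zero_le (m * b), Nat.zero_le (m * c), Nat.zero_le (m * e),
    Nat.zero_le (m * f), Nat.zero_le (m * g), Nat.zero_le m]

end RealizerProgram

theorem mainTheorem2 :
    ∃ (P : RAM.Program) (C : ℕ),
      ∀ (n D : ℕ) (M : PlaneGraph (Fin n)) (T : RootedSubtree M.graph)
        (num : M.graph.Dart ≃ Fin D) (s : RAM.State),
        M.IsTriangulation → M.IsOrderlySpanningTree T → RepresentsInput M T num s →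
        ∃ (t : ℕ) (s' : RAM.State) (T₁ T₂ Tₙ : RootedSubtree M.graph),
          RAM.Exec P s t s' ∧ t ≤ C * n ∧ RepresentsOutput T₁ T₂ Tₙ s' ∧
          M.IsRealizer T₁ T₂ Tₙ ∧
          T₁.root = T.root ∧ M.IsSecondNode T T₂.root ∧ M.IsLastNode T Tₙ.root ∧
          s(T.root, T₂.root) ∈ T.tree.edgeSet ∧ s(T.root, Tₙ.root) ∈ T.tree.edgeSet ∧
          T₁.tree.edgeSet = T.tree.edgeSet \ {s(T.root, T₂.root), s(T.root, Tₙ.root)} ∧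
          T₂.tree.edgeSet =
            {e | ∃ v w, M.IsInternalNode v ∧ M.IsLastInBlock v (M.B₂ T v) w ∧ e = s(v, w)} ∧
          Tₙ.tree.edgeSet =
            {e | ∃ v w, M.IsInternalNode v ∧ M.IsFirstInBlock v (M.B₄ T v) w ∧ e = s(v, w)} := by
  refine ⟨RealizerProgram.computeRealizer, RealizerProgram.timeFactor, ?_⟩
  intro n D M T num s hM hT hs
  obtain ⟨S⟩ := PlaneGraph.exists_tour hM hT
  have ho := hT.2.2
  obtain ⟨t, ht, s', hexec, hs'⟩ := RealizerProgram.exec_computeRealizer S ho hs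
  obtain ⟨T₁, hr₁, h₁, hc₁⟩ := S.exists_tree₁ ho
  obtain ⟨T₂, hr₂, h₂, hc₂⟩ := S.exists_tree₂ ho
  obtain ⟨Tₙ, hrₙ, hₙ, hcₙ⟩ := S.exists_treeₙ ho
  refine ⟨t, _, T₁, T₂, Tₙ, hexec, ht,
    RealizerProgram.eval_finish S ho hs' h₁ h₂ hₙ hr₁ hr₂ hrₙ,
    S.isRealizer ho h₁ h₂ hₙ hr₁ hr₂ hrₙ hc₁ hc₂ hcₙ, hr₁, ?_, ?_, ?_, ?_, ?_,
    PlaneGraph.Tour.edgeSet_eq_of_isParent_iff h₂, PlaneGraph.Tour.edgeSet_eq_of_isParent_iff hₙ⟩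
  · rw [hr₂]
    exact ⟨S.first_ne_root ho, fun u hu hu' => S.precedes_iff.mpr (S.key_first_lt ho hu hu')⟩
  · rw [hrₙ]
    exact fun u hu => S.precedes_iff.mpr (S.key_lt_last ho hu)
  · rw [hr₂]
    exact (S.isParent_first ho).1
  · rw [hrₙ]
    exact (S.isParent_last ho).1
  · rw [hr₂, hrₙ]
    exact S.edgeSet_tree₁ ho h₁
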